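/- Let $F$ be a finite group and let $G=\mathbb Z\wr F$ be the wreath product, i.e. the semidirect product of $\mathbb Z$ and the group $\Sigma F=\sum_{\mathbb Z}F$ of finitely supported functions $\mathbb Z\to F$, on which $\mathbb Z$ acts by shifts. Let $\mu$ define a standard simple switch-walk-switch random walk on $G$: $\mu=\mu_F*\mu_{\mathbb Z}*\mu_F$, where $\mu_{\mathbb Z}$ is a symmetric probability measure on $\mathbb Z\subset G$ with support $\{-1,0,1\}$, and $\mu_F$ is the uniform distribution on the copy of $F$ in $\Sigma F$ that sits over $0\in\mathbb Z$. Fix a finite generating set $S$ of $G$ and let $B(e,r)$ be the ball of radius $r$ around the identity in the word metric of $S$. (1) [Almost invariance.] For every $\varepsilon>0$ there are $c>0$ and sets $V_n\subset G$, $n\ge 0$, such that for all $n$: $\mu^{*n}(V_n)\ge 1-\varepsilon$, and for all $h\in V_n$ and all $g\in B(e,c\sqrt n)$ one has $\mu^{*n}(h)>0$ and $$\left|\frac{\mu^{*n}(hg)}{\mu^{*n}(h)}-1\right|\le\varepsilon .$$ In particular, the radius of almost invariance is $\succeq\sqrt n$, that is: for every function $r''$ with $r''(n)/\sqrt n\to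 0$ and every $\varepsilon>0$ there are sets $V_n\subset G$ with $\mu^{*n}(V_n)\ge 1-\varepsilon$ for all $n$, with $\mu^{*n}(h)>0$ for all $n$ and $h\in V_n$, and such that for all sufficiently large $n$ the displayed inequality holds for all $h\in V_n$ and all $g\in B(e,r''(n))$. (2) [Invariance.] For every $\varepsilon>0$ there are $c>0$ and sets $V_n\subset G$, $n\ge0$, such that for all $n$: $\mu^{*n}(V_n)\ge 1-\varepsilon$, and $\mu^{*n}(hg)=\mu^{*n}(h)$ for all $h\in V_n$ and all $g\in B(e,c\sqrt n)\cap\Sigma F$. -/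

import Mathlib

noncomputable section

open Filter Topology

/-- The direct sum `∑_A B`: finitely supported functions `A → B`, with pointwise multiplication. -/
def lampSubgroup (A B : Type*) [Group B] : Subgroup (A → B) where
  carrier := {f | f.mulSupport.Finite}
  one_mem' := by simp
  mul_mem' := by
    intro f g hf hg
    exact (hf.union hg).subset (Function.mulSupport_mul f g)
  inv_mem' := by
    intro f hf
    simpa [Function.mulSupport_inv] using hf

theorem mem_lampSubgroup {A B : Type*} [Group B] (f : A → B) :
    f ∈ lampSubgroup A B ↔ f.mulSupport.Finite := Iff.rfl

/-- The shift of a finitely supported function: `(a • f) x = f (a⁻¹ * x)`. -/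
def lampShift {A B : Type*} [Group A] [Group B] (a : A) (f : lampSubgroup A B) :
    lampSubgroup A B :=
  ⟨fun x => f.1 (a⁻¹ * x), by
    have hf : (Function.mulSupport f.1).Finite := f.2
    exact hf.preimage ((mul_right_injective a⁻¹).injOn)⟩

/-- The action of `A` on `∑_A B` by shifts. -/
def lampAction (A B : Type*) [Group A] [Group B] : A →* MulAut (lampSubgroup A B) where
  toFun a :=
    { toFun := lampShift a
      invFun := lampShift a⁻¹
      left_inv := fun f => by ext x; simp [lampShift]
      right_inv := fun f => by ext x; simp [lampShift]
      map_mul' := fun f g => by ext x; simp [lampShift] }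
  map_one' := by ext f x; simp [lampShift]
  map_mul' a b := by ext f x; simp [lampShift, mul_assoc]

/-- The (restricted) wreath product `A ≀ B`: the semidirect product of `∑_A B` and `A`, where `A`
acts by shifts. -/
abbrev WreathProduct (A B : Type*) [Group A] [Group B] : Type _ :=
  lampSubgroup A B ⋊[lampAction A B] A

/-- The element of `∑_A B` with value `b` at the identity and trivial elsewhere. -/
def lampAtOne (A : Type*) {B : Type*} [Group A] [Group B] (b : B) : lampSubgroup A B :=
  open Classical in
  ⟨Pi.mulSingle (1 : A) b, (Set.finite_singleton (1 : A)).subset Pi.mulSupport_mulSingle_subset⟩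

/-- The lamp group `∑_A B` as a subgroup of `A ≀ B`. -/
def lampGroup (A B : Type*) [Group A] [Group B] : Subgroup (WreathProduct A B) :=
  (SemidirectProduct.inl : lampSubgroup A B →* WreathProduct A B).range

/-- The convolution `μ * ν`: the law of `x * y`, for independent `x ∼ μ` and `y ∼ ν`. -/
def pmfConv {G : Type*} [Group G] (μ ν : PMF G) : PMF G :=
  μ.bind fun x => ν.map fun y => x * y

/-- The `n`-fold convolution `μ^{*n}`, the law of the random walk at time `n`. -/
def pmfConvPow {G : Type*} [Group G] (μ : PMF G) : ℕ → PMF G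
  | 0 => PMF.pure 1
  | n + 1 => pmfConv (pmfConvPow μ n) μ

/-- The `n`-step transition probability `μ^{*n}(g)`, as a real number. -/
def stepProb {G : Type*} [Group G] (μ : PMF G) (n : ℕ) (g : G) : ℝ :=
  (pmfConvPow μ n g).toReal

/-- The probability `μ^{*n}(V)` of a set, as a real number. -/
def stepProbSet {G : Type*} [Group G] (μ : PMF G) (n : ℕ) (V : Set G) : ℝ :=
  ((pmfConvPow μ n).toOuterMeasure V).toReal

/-- `μ = μ_B * μ_A * μ_B` on `A ≀ B`, with `A` and `B` embedded in the standard way (`B` as the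
copy sitting over the identity of `A`). -/
def IsSwitchWalkSwitch {A B : Type*} [Group A] [Group B]
    (μ : PMF (WreathProduct A B)) (μA : PMF A) (μB : PMF B) : Prop :=
  μ = pmfConv
    (pmfConv (μB.map fun b => (SemidirectProduct.inl (lampAtOne A b) : WreathProduct A B))
      (μA.map fun a => (SemidirectProduct.inr a : WreathProduct A B)))
    (μB.map fun b => (SemidirectProduct.inl (lampAtOne A b) : WreathProduct A B))

/-- The standard simple switch-walk-switch random walks on `ℤ ≀ F`: `μ_A` is symmetric with support
`{-1, 0, 1}`, and `μ_B` is the uniform distribution on `F`. -/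
def IsStandardSimpleSwitchWalkSwitch {F : Type*} [Group F] [Fintype F]
    (μ : PMF (WreathProduct (Multiplicative ℤ) F)) : Prop :=
  ∃ ν : PMF (Multiplicative ℤ),
    (∀ x, ν x⁻¹ = ν x) ∧
    ν.support = Multiplicative.ofAdd '' ({-1, 0, 1} : Set ℤ) ∧
    IsSwitchWalkSwitch μ ν (PMF.uniformOfFintype F)

/-- The word length with respect to `S`: the least length of a word in `S ∪ S⁻¹` representing `g`
(used only for generating sets `S`). -/
def wordLength {G : Type*} [Group G] (S : Set G) (g : G) : ℕ :=
  sInf {n | ∃ l : List G, (∀ x ∈ l, x ∈ S ∨ x⁻¹ ∈ S) ∧ l.prod = g ∧ l.length = n}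

/-- The ball of radius `r` around the identity in the word metric. -/
def wordBall {G : Type*} [Group G] (S : Set G) (r : ℝ) : Set G :=
  {g | (wordLength S g : ℝ) ≤ r}

/-- The random walk has almost invariant distributions on the scale `r(n)`. The points of `V n` have
positive probability, so that the ratios make sense. -/
def AlmostInvariantOnScale {G : Type*} [Group G] (S : Set G) (μ : PMF G) (r : ℕ → ℝ) : Prop :=
  ∀ ε : ℝ, 0 < ε → ∃ V : ℕ → Set G,
    (∀ n, 1 - ε ≤ stepProbSet μ n (V n)) ∧
    (∀ n, ∀ h ∈ V n, 0 < stepProb μ n h) ∧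
    ∀ᶠ n in atTop, ∀ h ∈ V n, ∀ g ∈ wordBall S (r n),
      |stepProb μ n (h * g) / stepProb μ n h - 1| ≤ ε

/-- The radius of almost invariance is asymptotically larger than `r`: almost invariance holds on
every scale `r''` with `r''(n) / r(n) → 0`. -/
def RadiusAlmostInvarianceGE {G : Type*} [Group G] (S : Set G) (μ : PMF G) (r : ℕ → ℝ) : Prop :=
  ∀ r'' : ℕ → ℝ, Tendsto (fun n => r'' n / r n) atTop (𝓝 0) → AlmostInvariantOnScale S μ r''

end

noncomputable section

open Filter Topology

/-! Since `μ_F` is idempotent, adjacent switches merge: after `n ≥ 1` steps the lamps over the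
interval visited by the projected lazy walk are independent and uniform. So `μ^{*n}(h)` is the sum,
over intervals `[a, b]` containing the nontrivial lamps of `h`, of `|F|^{-(b-a+1)}` times the
probability that the projected walk has range `[a, b]` and ends at the walker's position `m`. Only
`m` and the hull of the lamps matter.

With high probability the walker is at distance of order `√n` from both ends of its range: the
distance to the maximum is a reflected walk (`lazyWalk_return_le`). If `F` is nontrivial, the `L`
sites next to a given end are all trivial only with probability `|F|^{-L}`. For the remaining `h`,
changing lamps within `c√n` of the walker does not move the hull. This gives (2), and reduces (1) to
moving the walker (`LampsBeyond.lampDensity_mul`, `sum_expect_lampDensity_le`).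

For that, the total variation in `m` of the joint law of range and position, at distance at least
`δ√n` from the ends, must be `O(1/√n)`. Split by which end was discovered last. If it was the
maximum `b`, the law as a function `k(d)` of `d = b - m` solves the heat equation below `b`,
vanishes outside the interval, and receives new mass only at `d = 0`. Comparison with the linear
harmonic function `d + 1` shows that `k(d)/(d+1)` decreases in steps of two (`topLaw_ratio_anti`).
Abel summation then bounds `Σ (d+1)²|k(d) - k(d+2)|` by `8 Σ (d+1)k(d)`, whose total over all
intervals is `O(√n)`; where `d + 1` is at least of order `√n`, this gains a factor `1/n`. Laziness
turns two-step differences into one-step differences (`abs_step_sub_step_le`). Telescoping over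
`c√n` moves and Markov's inequality give (1).

If `F` is trivial, the same argument runs on the law of the lazy walk itself. -/

/-- A state of a nearest neighbour walk on `ℤ`: the visited interval `[lo, hi]`, the position, and
whether the last new site was a maximum. -/
structure RangeState where
  lo : ℤ
  hi : ℤ
  pos : ℤ
  top : Bool

/-! ### The chain of visited interval and position -/

namespace RangeState

/-- The state after a step `e` of the walk. -/
def move (e : ℤ) (s : RangeState) : RangeState :=
  if s.hi < s.pos + e then ⟨s.lo, s.pos + e, s.pos + e, true⟩
  else if s.pos + e < s.lo then ⟨s.pos + e, s.hi, s.pos + e, false⟩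
  else ⟨s.lo, s.hi, s.pos + e, s.top⟩

/-- The states that can occur after `n` steps. -/
def InRange (n : ℕ) (s : RangeState) : Prop :=
  -(n : ℤ) ≤ s.lo ∧ s.lo ≤ s.pos ∧ s.pos ≤ s.hi ∧ s.hi ≤ n

/-- The mirror image of a state. -/
def reflect (s : RangeState) : RangeState := ⟨-s.hi, -s.lo, -s.pos, !s.top⟩

theorem InRange.move {n : ℕ} {s : RangeState} (h : s.InRange n) {e : ℤ} (he : e = 1 ∨ e = -1) :
    (s.move e).InRange (n + 1) := by
  obtain ⟨h1, h2, h3, h4⟩ := h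
  unfold RangeState.move InRange
  split_ifs <;> push_cast <;> refine ⟨?_, ?_, ?_, ?_⟩ <;> omega

theorem move_reflect {n : ℕ} {s : RangeState} (h : s.InRange n) (e : ℤ) :
    s.reflect.move e = (s.move (-e)).reflect := by
  obtain ⟨h1, h2, h3, h4⟩ := h
  unfold RangeState.move reflect
  simp only
  split_ifs <;> first | omega | (simp; try omega)

end RangeState

open RangeState

/-- The transition operator of the lazy walk, acting on functions of the state. -/
def stepOp (p q : ℝ) : (RangeState → ℝ) →ₗ[ℝ] (RangeState → ℝ) where
  toFun f s := p * f s + q * (f (s.move 1) + f (s.move (-1)))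
  map_add' f g := by ext s; simp; ring
  map_smul' c f := by ext s; simp; ring

/-- The expectation of a function of the state after `n` steps. -/
def expect (p q : ℝ) (n : ℕ) (σ : Bool) : (RangeState → ℝ) →ₗ[ℝ] ℝ :=
  LinearMap.proj (⟨0, 0, 0, σ⟩ : RangeState) ∘ₗ (stepOp p q) ^ n

section Chain

variable {p q : ℝ} {n : ℕ} {σ : Bool}

theorem stepOp_apply (f : RangeState → ℝ) (s : RangeState) :
    stepOp p q f s = p * f s + q * (f (s.move 1) + f (s.move (-1))) := rfl

theorem expect_zero (f : RangeState → ℝ) : expect p q 0 σ f = f ⟨0, 0, 0, σ⟩ := rfl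

theorem expect_succ (f : RangeState → ℝ) :
    expect p q (n + 1) σ f = expect p q n σ (stepOp p q f) := by
  simp [expect, pow_succ]

/-- Later estimates are pointwise comparisons of functions of the state, valid only on reachable
states, where `lo ≤ pos ≤ hi`. -/
theorem expect_mono (hp : 0 ≤ p) (hq : 0 ≤ q) {f g : RangeState → ℝ}
    (h : ∀ s : RangeState, s.InRange n → f s ≤ g s) : expect p q n σ f ≤ expect p q n σ g := by
  induction n generalizing f g with
  | zero => exact h _ (by simp [InRange])
  | succ n ih =>
    rw [expect_succ, expect_succ]
    refine ih fun s hs => ?_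
    have hs' : s.InRange (n + 1) := by
      obtain ⟨h1, h2, h3, h4⟩ := hs
      refine ⟨?_, h2, h3, ?_⟩ <;> push_cast <;> omega
    have := h s hs'
    have h1 := h _ (hs.move (Or.inl rfl))
    have h2 := h _ (hs.move (Or.inr rfl))
    rw [stepOp_apply, stepOp_apply]
    gcongr

theorem expect_congr (hp : 0 ≤ p) (hq : 0 ≤ q) {f g : RangeState → ℝ}
    (h : ∀ s : RangeState, s.InRange n → f s = g s) : expect p q n σ f = expect p q n σ g :=
  le_antisymm (expect_mono hp hq fun s hs => (h s hs).le)
    (expect_mono hp hq fun s hs => (h s hs).ge)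

theorem expect_nonneg (hp : 0 ≤ p) (hq : 0 ≤ q) {f : RangeState → ℝ}
    (h : ∀ s : RangeState, s.InRange n → 0 ≤ f s) : 0 ≤ expect p q n σ f := by
  have := expect_mono (σ := σ) hp hq (f := 0) (g := f) (n := n) h
  simpa using this

theorem expect_const (hpq : p + 2 * q = 1) (c : ℝ) : expect p q n σ (fun _ => c) = c := by
  induction n with
  | zero => rfl
  | succ n ih =>
    have h : stepOp p q (fun _ => c) = fun _ => c := by
      ext s
      rw [stepOp_apply]
      linear_combination c * hpq
    rw [expect_succ, h, ih]

/-- Transfers every statement about the maximum to the minimum. The initial flag is flipped, which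
is why `σ` is kept arbitrary. -/
theorem expect_reflect (hp : 0 ≤ p) (hq : 0 ≤ q) (f : RangeState → ℝ) :
    expect p q n σ (fun s => f s.reflect) = expect p q n (!σ) f := by
  induction n generalizing f with
  | zero => rfl
  | succ n ih =>
    rw [expect_succ, expect_succ, ← ih]
    refine expect_congr hp hq fun s hs => ?_
    rw [stepOp_apply, stepOp_apply, move_reflect hs, move_reflect hs, neg_neg]
    ring

/-! ### The distance to the maximum -/

/-- `D = hi - pos` is a walk reflected at `0`, where an up step leaves it in place. The function
`D(D+1)` gains exactly `2q` per step on average, also at `D = 0`. -/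
theorem expect_sq_drawdown (hp : 0 ≤ p) (hq : 0 ≤ q) (hpq : p + 2 * q = 1) :
    expect p q n σ (fun s => ((s.hi - s.pos : ℤ) : ℝ) * ((s.hi - s.pos : ℤ) + 1)) = 2 * q * n := by
  induction n with
  | zero => simp [expect_zero]
  | succ n ih =>
    rw [expect_succ]
    have key : expect p q n σ (stepOp p q
        (fun s => ((s.hi - s.pos : ℤ) : ℝ) * ((s.hi - s.pos : ℤ) + 1))) =
        expect p q n σ ((fun s => ((s.hi - s.pos : ℤ) : ℝ) * ((s.hi - s.pos : ℤ) + 1)) +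
          fun _ => 2 * q) := by
      refine expect_congr hp hq fun s hs => ?_
      obtain ⟨h1, h2, h3, h4⟩ := hs
      rw [stepOp_apply]
      have e1 : (((s.move (-1)).hi - (s.move (-1)).pos : ℤ) : ℝ) = ((s.hi - s.pos : ℤ) : ℝ) + 1 := by
        unfold move
        split_ifs <;> first | omega | (push_cast; ring)
      simp only [Pi.add_apply]
      rw [e1]
      by_cases hD : s.hi = s.pos
      · have e2 : (((s.move 1).hi - (s.move 1).pos : ℤ) : ℝ) = 0 := by
          unfold move
          rw [if_pos (by omega)]; simp
        rw [e2, hD]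
        simp
        ring
      · have e2 : (((s.move 1).hi - (s.move 1).pos : ℤ) : ℝ) = ((s.hi - s.pos : ℤ) : ℝ) - 1 := by
          unfold move
          rw [if_neg (by omega), if_neg (by omega)]; push_cast; ring
        rw [e2]
        linear_combination (((s.hi - s.pos : ℤ) : ℝ) * ((s.hi - s.pos : ℤ) + 1)) * hpq
    rw [key, map_add, ih, expect_const hpq]
    push_cast; ring

theorem expect_drawdown_le (hp : 0 ≤ p) (hq : 0 ≤ q) (hpq : p + 2 * q = 1) :
    expect p q n σ (fun s => ((s.hi - s.pos : ℤ) : ℝ)) ≤ √n := by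
  rcases Nat.eq_zero_or_pos n with rfl | hn
  · simp [expect_zero]
  have hn' : (0 : ℝ) < √n := Real.sqrt_pos.2 (by exact_mod_cast hn)
  have hsq : √(n : ℝ) * √n = n := Real.mul_self_sqrt (by positivity)
  -- By AM-GM, `2√n D ≤ D(D+1) + n`; in the end `q ≤ 1/2` is used.
  have h1 : expect p q n σ (fun s => ((s.hi - s.pos : ℤ) : ℝ)) ≤ expect p q n σ
      ((1 / (2 * √n)) • (fun s : RangeState => ((s.hi - s.pos : ℤ) : ℝ) * ((s.hi - s.pos : ℤ) + 1))
        + fun _ => √n / 2) := by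
    refine expect_mono hp hq fun s hs => ?_
    have hD : (0 : ℝ) ≤ ((s.hi - s.pos : ℤ) : ℝ) := by
      exact_mod_cast sub_nonneg.2 hs.2.2.1
    simp only [Pi.add_apply, Pi.smul_apply, smul_eq_mul]
    generalize ((s.hi - s.pos : ℤ) : ℝ) = D at hD
    have : 1 / (2 * √n) * (D * (D + 1)) + √n / 2 = (D * (D + 1) + √n * √n) / (2 * √n) := by
      field_simp
    rw [this, le_div_iff₀ (by positivity)]
    nlinarith [sq_nonneg (D - √n)]
  refine h1.trans ?_
  rw [map_add, map_smul, expect_sq_drawdown hp hq hpq, expect_const hpq, smul_eq_mul]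
  have : 1 / (2 * √n) * (2 * q * n) = q * √n := by
    field_simp; linear_combination -q * hsq
  rw [this]
  nlinarith

/-! ### The lazy walk on `ℤ` -/

/-- The law of the lazy nearest neighbour walk on `ℤ` after `n` steps. -/
def lazyWalk (p q : ℝ) : ℕ → ℤ → ℝ
  | 0, m => if m = 0 then 1 else 0
  | n + 1, m => p * lazyWalk p q n m + q * (lazyWalk p q n (m - 1) + lazyWalk p q n (m + 1))

theorem lazyWalk_nonneg (hp : 0 ≤ p) (hq : 0 ≤ q) (m : ℤ) : 0 ≤ lazyWalk p q n m := by
  induction n generalizing m with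
  | zero => rw [lazyWalk]; split_ifs <;> simp
  | succ n ih =>
    rw [lazyWalk]
    have := ih m; have := ih (m - 1); have := ih (m + 1)
    positivity

theorem lazyWalk_neg (m : ℤ) : lazyWalk p q n (-m) = lazyWalk p q n m := by
  induction n generalizing m with
  | zero => simp [lazyWalk]
  | succ n ih =>
    rw [lazyWalk, lazyWalk, ih, ← ih (m - 1), ← ih (m + 1)]
    rw [show -m - 1 = -(m + 1) by ring, show -m + 1 = -(m - 1) by ring]
    ring

/-- Steps of two are needed because with little laziness monotonicity can fail between neighbours.
At `m = -1` symmetry gives equality, which closes the induction. -/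
theorem lazyWalk_add_two_le (hp : 0 ≤ p) (hq : 0 ≤ q) {m : ℤ} (hm : -1 ≤ m) :
    lazyWalk p q n (m + 2) ≤ lazyWalk p q n m := by
  induction n generalizing m with
  | zero =>
    rw [lazyWalk, lazyWalk, if_neg (by omega)]; split_ifs <;> simp
  | succ n ih =>
    rcases eq_or_lt_of_le hm with rfl | hm'
    · rw [lazyWalk_neg 1]; norm_num
    · rw [lazyWalk, lazyWalk]
      have h1 := ih hm
      have h2 := ih (m := m - 1) (by omega)
      have h3 := ih (m := m + 1) (by omega)
      rw [show m - 1 + 2 = m + 2 - 1 by ring] at h2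
      rw [show m + 1 + 2 = m + 2 + 1 by ring] at h3
      gcongr

/-- The sum is the probability of zero drawdown; its monotonicity in time lets the last value be
bounded by the time average. -/
theorem lazyWalk_zero_add_one_anti (hp : 0 ≤ p) (hq : 0 ≤ q) (hpq : p + 2 * q = 1) :
    lazyWalk p q (n + 1) 0 + lazyWalk p q (n + 1) 1 ≤ lazyWalk p q n 0 + lazyWalk p q n 1 := by
  rw [lazyWalk, lazyWalk]
  have h1 : lazyWalk p q n (0 - 1) = lazyWalk p q n 1 := by
    rw [zero_sub, lazyWalk_neg]
  have h2 := lazyWalk_add_two_le (n := n) hp hq (m := 0) (by omega)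
  rw [h1]
  norm_num at h2 ⊢
  have h3 := mul_le_mul_of_nonneg_left h2 hq
  linear_combination h3 + (lazyWalk p q n 0 + lazyWalk p q n 1) * hpq

/-- The drawdown is the lazy walk folded by `m ↦ -1 - m`, since both stay at `0` with probability `p
+ q`. Symmetry replaces `-1 - d` by `d + 1`. -/
theorem expect_drawdown_eq (hp : 0 ≤ p) (hq : 0 ≤ q) {d : ℤ} (hd : 0 ≤ d) :
    expect p q n σ (fun s => if s.hi - s.pos = d then 1 else 0) =
      lazyWalk p q n d + lazyWalk p q n (d + 1) := by
  induction n generalizing d with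
  | zero =>
    rw [expect_zero, lazyWalk, lazyWalk, if_neg (show d + 1 ≠ 0 by omega)]
    simp [eq_comm]
  | succ n ih =>
    have key : expect p q (n + 1) σ (fun s => if s.hi - s.pos = d then 1 else 0) =
        expect p q n σ (p • (fun s => if s.hi - s.pos = d then (1 : ℝ) else 0) +
          q • ((fun s => if s.hi - s.pos = (if d = 0 then 0 else d - 1) then (1 : ℝ) else 0) +
          (fun s => if s.hi - s.pos = d + 1 then (1 : ℝ) else 0))) := by
      rw [expect_succ]
      refine expect_congr hp hq fun s hs => ?_
      obtain ⟨h1, h2, h3, h4⟩ := hs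
      rw [stepOp_apply]
      simp only [Pi.add_apply, Pi.smul_apply, smul_eq_mul]
      have e1 : (s.move (-1)).hi - (s.move (-1)).pos = s.hi - s.pos + 1 := by
        unfold move
        split_ifs <;> simp only <;> omega
      have e2 : (s.move 1).hi - (s.move 1).pos = if s.hi = s.pos then 0 else s.hi - s.pos - 1 := by
        unfold move
        split_ifs <;> simp only <;> omega
      rw [e1, e2]
      congr 2
      split_ifs <;> first | omega | simp
    rw [key]
    simp only [map_add, map_smul, smul_eq_mul]
    rw [ih hd, ih (d := d + 1) (by omega), ih (d := if d = 0 then 0 else d - 1) (by split_ifs <;> omega)]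
    simp only [lazyWalk]
    split_ifs with h0
    · subst h0
      have : lazyWalk p q n (0 - 1) = lazyWalk p q n 1 := by rw [zero_sub, lazyWalk_neg]
      rw [this]; norm_num; ring
    · simp only [sub_add_cancel, add_sub_cancel_right]; ring

/-- The mean drawdown grows at each step by `q` times the probability of zero drawdown. That
probability is nonincreasing, so `n` times `q` times its last value is at most the mean drawdown,
hence at most `√n`. -/
theorem lazyWalk_return_le (hp : 0 ≤ p) (hq : 0 < q) (hpq : p + 2 * q = 1) :
    q * √n * (lazyWalk p q n 0 + lazyWalk p q n 1) ≤ 1 := by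
  have key : n * (q * (lazyWalk p q n 0 + lazyWalk p q n 1)) ≤
      expect p q n true (fun s => ((s.hi - s.pos : ℤ) : ℝ)) := by
    induction n with
    | zero => simp [expect_zero]
    | succ n ih =>
      have h1 : expect p q (n + 1) true (fun s => ((s.hi - s.pos : ℤ) : ℝ)) =
          expect p q n true ((fun s => ((s.hi - s.pos : ℤ) : ℝ)) +
            q • (fun s => if s.hi - s.pos = 0 then (1 : ℝ) else 0)) := by
        rw [expect_succ]
        refine expect_congr hp hq.le fun s hs => ?_
        obtain ⟨h1, h2, h3, h4⟩ := hs
        rw [stepOp_apply]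
        simp only [Pi.add_apply, Pi.smul_apply, smul_eq_mul]
        have e1 : (s.move (-1)).hi - (s.move (-1)).pos = s.hi - s.pos + 1 := by
          unfold move
          split_ifs <;> simp only <;> omega
        have e2 : (s.move 1).hi - (s.move 1).pos =
            s.hi - s.pos - 1 + if s.hi - s.pos = 0 then 1 else 0 := by
          unfold move
          split_ifs <;> simp only <;> omega
        rw [e1, e2]
        push_cast
        split_ifs with h <;> linear_combination ((s.hi : ℝ) - s.pos) * hpq
      rw [h1, map_add, map_smul, expect_drawdown_eq hp hq.le le_rfl, smul_eq_mul, zero_add]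
      have h2 := lazyWalk_zero_add_one_anti (n := n) hp hq.le hpq
      have h3 : ((n + 1 : ℕ) : ℝ) * (q * (lazyWalk p q (n + 1) 0 + lazyWalk p q (n + 1) 1)) ≤
        (n + 1 : ℕ) * (q * (lazyWalk p q n 0 + lazyWalk p q n 1)) := by gcongr
      refine h3.trans ?_
      rw [Nat.cast_add, Nat.cast_one, add_mul, one_mul]
      exact add_le_add_left ih _
  have h2 := key.trans (expect_drawdown_le hp hq.le hpq)
  rcases Nat.eq_zero_or_pos n with rfl | hn
  · simp
  have hn' : (0 : ℝ) < √n := Real.sqrt_pos.2 (by exact_mod_cast hn)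
  have hsq : √(n : ℝ) * √n = n := Real.mul_self_sqrt (by positivity)
  refine le_of_mul_le_mul_left ?_ hn'
  calc √n * (q * √n * (lazyWalk p q n 0 + lazyWalk p q n 1))
      = n * (q * (lazyWalk p q n 0 + lazyWalk p q n 1)) := by
        linear_combination (q * (lazyWalk p q n 0 + lazyWalk p q n 1)) * hsq
    _ ≤ √n * 1 := by rw [mul_one]; exact h2

/-- No value of the drawdown is more likely than `0`; sum over `R` values. -/
theorem expect_drawdown_lt_le (hp : 0 ≤ p) (hq : 0 < q) (hpq : p + 2 * q = 1) (R : ℕ) :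
    q * √n * expect p q n σ (fun s => if s.hi - s.pos < R then 1 else 0) ≤ R := by
  have h1 : expect p q n σ (fun s => if s.hi - s.pos < R then 1 else 0) =
      expect p q n σ (∑ d ∈ Finset.range R, fun s => if s.hi - s.pos = d then (1 : ℝ) else 0) := by
    refine expect_congr hp hq.le fun s hs => ?_
    obtain ⟨h1, h2, h3, h4⟩ := hs
    obtain ⟨D, hD⟩ := Int.eq_ofNat_of_zero_le (show 0 ≤ s.hi - s.pos by omega)
    simp [Finset.sum_apply, hD]
  rw [h1, map_sum, Finset.mul_sum]
  have h2 : ∀ d : ℕ, lazyWalk p q n d + lazyWalk p q n (d + 1) ≤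
      lazyWalk p q n 0 + lazyWalk p q n 1 := by
    intro d
    induction d with
    | zero => simp
    | succ d ih =>
      refine le_trans ?_ ih
      have := lazyWalk_add_two_le (n := n) hp hq.le (m := d) (by omega)
      push_cast
      rw [show (d : ℤ) + 1 + 1 = d + 2 by ring]
      linarith
  calc _ ≤ ∑ d ∈ Finset.range R, (1 : ℝ) := by
        refine Finset.sum_le_sum fun d _ => ?_
        rw [expect_drawdown_eq hp hq.le (by positivity)]
        refine le_trans ?_ (lazyWalk_return_le (n := n) hp hq hpq)
        exact mul_le_mul_of_nonneg_left (h2 d) (by positivity)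
    _ = R := by simp

theorem expect_drawup_lt_le (hp : 0 ≤ p) (hq : 0 < q) (hpq : p + 2 * q = 1) (R : ℕ) :
    q * √n * expect p q n σ (fun s => if s.pos - s.lo < R then 1 else 0) ≤ R := by
  have := expect_drawdown_lt_le (n := n) (σ := !σ) hp hq hpq R
  rw [← expect_reflect hp hq.le] at this
  simpa [reflect, neg_add_eq_sub] using this

end Chain

/-! ### Variation of the joint law of range and position -/

/-- A weighted variation bound for `k d = (d + 1) * g d`, where `g` decreases in steps of two. -/
theorem sum_sq_mul_abs_sub_le {k g : ℕ → ℝ} (hk : ∀ d, k d = (d + 1) * g d) (hg : ∀ d, 0 ≤ g d)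
    (hanti : ∀ d, g (d + 2) ≤ g d) (M : ℕ) :
    ∑ d ∈ Finset.range M, ((d : ℝ) + 1) ^ 2 * |k d - k (d + 2)| ≤
      8 * ∑ d ∈ Finset.range (M + 2), ((d : ℝ) + 1) * k d := by
  -- Abel summation. The shift by two leaves two boundary terms, and the induction needs `(M+3)³ -
  -- (M+1)³ ≤ 6(M+3)²`.
  have h1 : ∑ d ∈ Finset.range M, ((d : ℝ) + 1) ^ 3 * (g d - g (d + 2)) +
      ((M : ℝ) + 1) ^ 3 * g M + ((M : ℝ) + 2) ^ 3 * g (M + 1) ≤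
      6 * ∑ d ∈ Finset.range (M + 2), ((d : ℝ) + 1) ^ 2 * g d := by
    induction M with
    | zero =>
      simp [Finset.sum_range_succ]
      nlinarith [hg 0, hg 1]
    | succ M ih =>
      rw [Finset.sum_range_succ, show M + 1 + 2 = (M + 2) + 1 by ring,
        Finset.sum_range_succ _ (M + 2)]
      push_cast at ih ⊢
      rw [show M + 1 + 1 = M + 2 by ring]
      have : (0 : ℝ) ≤ M := by positivity
      nlinarith [hg (M + 2), mul_nonneg this (hg (M + 2))]
  have h2 : ∑ d ∈ Finset.range M, ((d : ℝ) + 1) ^ 2 * g (d + 2) ≤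
      ∑ d ∈ Finset.range (M + 2), ((d : ℝ) + 1) ^ 2 * g d := by
    rw [Finset.sum_range_succ' _ (M + 1), Finset.sum_range_succ' _ M]
    have : ∑ d ∈ Finset.range M, ((d : ℝ) + 1) ^ 2 * g (d + 2) ≤
        ∑ d ∈ Finset.range M, (((d + 1 + 1 : ℕ) : ℝ) + 1) ^ 2 * g (d + 1 + 1) := by
      refine Finset.sum_le_sum fun d _ => ?_
      have := hg (d + 2)
      rw [show d + 1 + 1 = d + 2 by ring]
      push_cast
      gcongr
      linarith
    refine this.trans ?_
    rw [add_assoc]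
    exact le_add_of_nonneg_right
      (add_nonneg (mul_nonneg (by positivity) (hg _)) (mul_nonneg (by positivity) (hg _)))
  have h3 : ∑ d ∈ Finset.range (M + 2), ((d : ℝ) + 1) * k d =
      ∑ d ∈ Finset.range (M + 2), ((d : ℝ) + 1) ^ 2 * g d := by
    refine Finset.sum_congr rfl fun d _ => ?_
    rw [hk]; ring
  have h4 : ∑ d ∈ Finset.range M, ((d : ℝ) + 1) ^ 2 * |k d - k (d + 2)| ≤
      ∑ d ∈ Finset.range M, ((d : ℝ) + 1) ^ 3 * (g d - g (d + 2)) +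
      2 * ∑ d ∈ Finset.range M, ((d : ℝ) + 1) ^ 2 * g (d + 2) := by
    rw [Finset.mul_sum, ← Finset.sum_add_distrib]
    refine Finset.sum_le_sum fun d _ => ?_
    -- Here `k d - k (d+2) = (d+1)(g d - g (d+2)) - 2 g (d+2)`, a nonnegative term minus a
    -- nonnegative term.
    have e : |k d - k (d + 2)| ≤ (d + 1) * (g d - g (d + 2)) + 2 * g (d + 2) := by
      rw [hk, hk]
      push_cast
      have := hanti d
      have := hg (d + 2)
      have : 0 ≤ ((d : ℝ) + 1) * (g d - g (d + 2)) := by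
        apply mul_nonneg (by positivity); linarith
      rw [abs_le]
      constructor <;> nlinarith
    calc _ ≤ ((d : ℝ) + 1) ^ 2 * ((d + 1) * (g d - g (d + 2)) + 2 * g (d + 2)) := by gcongr
      _ = _ := by ring
  have h5 : 0 ≤ ((M : ℝ) + 1) ^ 3 * g M := mul_nonneg (by positivity) (hg _)
  have h6 : 0 ≤ ((M : ℝ) + 2) ^ 3 * g (M + 1) := mul_nonneg (by positivity) (hg _)
  rw [h3]
  linarith

/-- The probability of visited interval `[a, b]` and position `m`. -/
def rangeLaw (p q : ℝ) (n : ℕ) (σ : Bool) (a b m : ℤ) : ℝ :=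
  expect p q n σ fun s => if s.lo = a ∧ s.hi = b ∧ s.pos = m then 1 else 0

/-- The part of `rangeLaw` where the last new site was a maximum. -/
def topLaw (p q : ℝ) (n : ℕ) (σ : Bool) (a b m : ℤ) : ℝ :=
  expect p q n σ fun s => if s.lo = a ∧ s.hi = b ∧ s.pos = m ∧ s.top = true then 1 else 0

section Chain

variable {p q : ℝ} {n : ℕ} {σ : Bool}

theorem topLaw_nonneg (hp : 0 ≤ p) (hq : 0 ≤ q) (a b m : ℤ) : 0 ≤ topLaw p q n σ a b m :=
  expect_nonneg hp hq fun s _ => by split_ifs <;> simp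

theorem topLaw_eq_zero (hp : 0 ≤ p) (hq : 0 ≤ q) {a b m : ℤ} (h : m < a ∨ b < m) :
    topLaw p q n σ a b m = 0 := by
  refine (expect_congr hp hq (g := 0) fun s hs => ?_).trans (map_zero _)
  obtain ⟨h1, h2, h3, h4⟩ := hs
  rw [if_neg (by omega)]; rfl

theorem rangeLaw_eq_topLaw_add (hp : 0 ≤ p) (hq : 0 ≤ q) (a b m : ℤ) :
    rangeLaw p q n σ a b m = topLaw p q n σ a b m + topLaw p q n (!σ) (-b) (-a) (-m) := by
  rw [topLaw, topLaw, rangeLaw, ← expect_reflect (σ := σ) hp hq, ← map_add]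
  congr 1
  ext s
  rcases s with ⟨lo, hi, pos, top⟩
  cases top <;> simp [reflect, and_comm, and_left_comm]

/-- Strict inequality is possible only at `m = b`, where walks that have just discovered `b` add
mass. -/
theorem topLaw_succ_ge (hp : 0 ≤ p) (hq : 0 ≤ q) {a b m : ℤ} (ha : a ≤ m) (hb : m ≤ b) :
    p * topLaw p q n σ a b m + q * (topLaw p q n σ a b (m - 1) + topLaw p q n σ a b (m + 1)) ≤
      topLaw p q (n + 1) σ a b m := by
  simp only [topLaw]
  rw [expect_succ]
  simp only [← smul_eq_mul, ← map_add, ← map_smul]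
  refine expect_mono hp hq fun s hs => ?_
  obtain ⟨h1, h2, h3, h4⟩ := hs
  rw [stepOp_apply]
  simp only [Pi.add_apply, Pi.smul_apply, smul_eq_mul]
  have hU : (s.lo = a ∧ s.hi = b ∧ s.pos = m - 1 ∧ s.top = true) →
      ((s.move 1).lo = a ∧ (s.move 1).hi = b ∧ (s.move 1).pos = m ∧ (s.move 1).top = true) := by
    rintro ⟨h5, h6, h7, h8⟩
    unfold move
    rw [if_neg (by omega), if_neg (by omega)]
    exact ⟨h5, h6, by simp only; omega, h8⟩
  have hD : (s.lo = a ∧ s.hi = b ∧ s.pos = m + 1 ∧ s.top = true) →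
      ((s.move (-1)).lo = a ∧ (s.move (-1)).hi = b ∧ (s.move (-1)).pos = m ∧
        (s.move (-1)).top = true) := by
    rintro ⟨h5, h6, h7, h8⟩
    unfold move
    rw [if_neg (by omega), if_neg (by omega)]
    exact ⟨h5, h6, by simp only; omega, h8⟩
  gcongr
  · split_ifs with h5 h6 <;> first | exact absurd (hU h5) h6 | simp
  · split_ifs with h5 h6 <;> first | exact absurd (hD h5) h6 | simp

theorem topLaw_succ_le (hp : 0 ≤ p) (hq : 0 ≤ q) {a b m : ℤ} (hb : m < b) :
    topLaw p q (n + 1) σ a b m ≤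
      p * topLaw p q n σ a b m + q * (topLaw p q n σ a b (m - 1) + topLaw p q n σ a b (m + 1)) := by
  simp only [topLaw]
  rw [expect_succ]
  simp only [← smul_eq_mul, ← map_add, ← map_smul]
  refine expect_mono hp hq fun s hs => ?_
  obtain ⟨h1, h2, h3, h4⟩ := hs
  rw [stepOp_apply]
  simp only [Pi.add_apply, Pi.smul_apply, smul_eq_mul]
  have hU : ((s.move 1).lo = a ∧ (s.move 1).hi = b ∧ (s.move 1).pos = m ∧ (s.move 1).top = true) →
      (s.lo = a ∧ s.hi = b ∧ s.pos = m - 1 ∧ s.top = true) := by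
    unfold move
    split_ifs <;> rintro ⟨h5, h6, h7, h8⟩ <;> simp only at h5 h6 h7 h8
    · omega
    · exact ⟨h5, h6, by omega, h8⟩
  have hD : ((s.move (-1)).lo = a ∧ (s.move (-1)).hi = b ∧ (s.move (-1)).pos = m ∧
        (s.move (-1)).top = true) → (s.lo = a ∧ s.hi = b ∧ s.pos = m + 1 ∧ s.top = true) := by
    unfold move
    split_ifs <;> rintro ⟨h5, h6, h7, h8⟩ <;> simp only at h5 h6 h7 h8
    · omega
    · exact ⟨h5, h6, by omega, h8⟩
  gcongr
  · split_ifs with h5 h6 <;> first | exact absurd (hU h5) h6 | simp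
  · split_ifs with h5 h6 <;> first | exact absurd (hD h5) h6 | simp

/-- The interval grows only when the walker lands on a new endpoint, so the heat equation is exact
at interior sites. -/
theorem rangeLaw_succ (hp : 0 ≤ p) (hq : 0 ≤ q) {a b m : ℤ} (ha : a < m) (hb : m < b) :
    rangeLaw p q (n + 1) σ a b m = p * rangeLaw p q n σ a b m +
      q * (rangeLaw p q n σ a b (m - 1) + rangeLaw p q n σ a b (m + 1)) := by
  simp only [rangeLaw_eq_topLaw_add hp hq]
  rw [le_antisymm (topLaw_succ_le hp hq hb) (topLaw_succ_ge hp hq ha.le hb.le),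
    le_antisymm (topLaw_succ_le hp hq (m := -m) (by omega))
      (topLaw_succ_ge hp hq (m := -m) (by omega) (by omega)),
    show -(m - 1) = -m + 1 by ring, show -(m + 1) = -m - 1 by ring]
  ring

/-- In terms of `d = b - m`, the weight `d + 1` is harmonic and vanishes at `b + 1`, as the law
does. A heat step preserves the decrease of the ratio in steps of two, and new mass at `b` only
helps. -/
theorem topLaw_ratio_anti (hp : 0 ≤ p) (hq : 0 ≤ q) (a b : ℤ) (d : ℕ) :
    ((d : ℝ) + 1) * topLaw p q n σ a b (b - d - 2) ≤ (d + 3) * topLaw p q n σ a b (b - d) := by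
  induction n generalizing d with
  | zero =>
    have h : topLaw p q 0 σ a b (b - d - 2) = 0 := by
      rw [topLaw, expect_zero, if_neg (by dsimp only; omega)]
    rw [h, mul_zero]
    have := topLaw_nonneg (n := 0) (σ := σ) hp hq a b (b - d)
    positivity
  | succ n ih =>
    have hn := topLaw_nonneg (p := p) (q := q) (n := n + 1) (σ := σ) hp hq a b (b - d)
    rcases lt_or_ge (b - d - 2) a with h | h
    · rw [topLaw_eq_zero hp hq (Or.inl h), mul_zero]
      positivity
    have h1 := topLaw_succ_le (n := n) (σ := σ) hp hq (a := a) (b := b) (m := b - d - 2) (by omega)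
    have h2 := topLaw_succ_ge (n := n) (σ := σ) hp hq (a := a) (b := b) (m := b - d) (by omega)
      (by omega)
    have h3 := ih d
    have h4 := ih (d + 1)
    push_cast at h4
    rw [show b - d - 2 + 1 = b - d - 1 by ring] at h1
    rw [show b - ((d : ℤ) + 1) - 2 = b - d - 2 - 1 by ring,
      show b - ((d : ℤ) + 1) = b - d - 1 by ring] at h4
    -- The inequality for `d - 1`; at `d = 0` its left side vanishes.
    have h5 : (d : ℝ) * topLaw p q n σ a b (b - d - 1) ≤
        (d + 2) * topLaw p q n σ a b (b - d + 1) := by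
      rcases d with _ | d
      · have := topLaw_nonneg (p := p) (q := q) (n := n) (σ := σ) hp hq a b (b - (0 : ℕ) + 1)
        simp only [Nat.cast_zero, zero_mul] at this ⊢
        positivity
      · have := ih d
        push_cast
        rw [show b - ((d : ℤ) + 1) - 1 = b - d - 2 by ring,
          show b - ((d : ℤ) + 1) + 1 = b - d by ring]
        linarith
    generalize topLaw p q n σ a b (b - d - 2 - 1) = x3 at *
    generalize topLaw p q n σ a b (b - d - 2) = x2 at *
    generalize topLaw p q n σ a b (b - d - 1) = x1 at *
    generalize topLaw p q n σ a b (b - d) = x0 at *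
    generalize topLaw p q n σ a b (b - d + 1) = y1 at *
    have hd : (0 : ℝ) ≤ d := by positivity
    -- After multiplication by `d + 2` this is `(d+1)` times `h4` plus `(d+3)` times `h5`.
    have key : ((d : ℝ) + 1) * (x3 + x1) ≤ (d + 3) * (x1 + y1) := by
      have hd2 : (0 : ℝ) < d + 2 := by positivity
      refine le_of_mul_le_mul_left ?_ hd2
      have := mul_le_mul_of_nonneg_left h4 (show (0 : ℝ) ≤ d + 1 by positivity)
      have := mul_le_mul_of_nonneg_left h5 (show (0 : ℝ) ≤ d + 3 by positivity)
      linarith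
    calc ((d : ℝ) + 1) * topLaw p q (n + 1) σ a b (b - d - 2)
        ≤ (d + 1) * (p * x2 + q * (x3 + x1)) := by gcongr
      _ = p * ((d + 1) * x2) + q * ((d + 1) * (x3 + x1)) := by ring
      _ ≤ p * ((d + 3) * x0) + q * ((d + 3) * (x1 + y1)) := by gcongr
      _ = (d + 3) * (p * x0 + q * (x1 + y1)) := by ring
      _ ≤ _ := by gcongr

/-- Distinct pairs (interval, `d`) are disjoint events with drawdown `d`, so the sum is at most the
mean of drawdown plus one. -/
theorem sum_topLaw_le (hp : 0 ≤ p) (hq : 0 ≤ q) (hpq : p + 2 * q = 1) (A : Finset (ℤ × ℤ))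
    (M : ℤ × ℤ → ℕ) :
    ∑ x ∈ A, ∑ d ∈ Finset.range (M x), ((d : ℝ) + 1) * topLaw p q n σ x.1 x.2 (x.2 - d) ≤
      1 + √n := by
  have h1 : expect p q n σ ((fun _ => 1) + fun s => ((s.hi - s.pos : ℤ) : ℝ)) ≤ 1 + √n := by
    rw [map_add, expect_const hpq]
    gcongr
    exact expect_drawdown_le hp hq hpq
  refine le_trans ?_ h1
  simp only [topLaw, ← smul_eq_mul, ← map_smul, ← map_sum]
  refine expect_mono hp hq fun s hs => ?_
  obtain ⟨D, hD⟩ := Int.eq_ofNat_of_zero_le (sub_nonneg.2 hs.2.2.1)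
  simp only [Finset.sum_apply, Pi.add_apply, Pi.smul_apply, smul_eq_mul, hD]
  have h2 : ∀ x ∈ A, ∑ d ∈ Finset.range (M x), ((d : ℝ) + 1) *
      (if s.lo = x.1 ∧ s.hi = x.2 ∧ s.pos = x.2 - d ∧ s.top = true then 1 else 0) ≤
      if x = (s.lo, s.hi) then ((D : ℝ) + 1) else 0 := by
    intro x _
    split_ifs with hx
    · subst hx
      calc _ ≤ ∑ d ∈ Finset.range (M (s.lo, s.hi)), if d = D then ((D : ℝ) + 1) else 0 := by
            refine Finset.sum_le_sum fun d _ => ?_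
            by_cases hd : d = D
            · subst hd
              rw [if_pos rfl]
              split_ifs
              · simp
              · rw [mul_zero]; positivity
            · rw [if_neg hd, if_neg (by dsimp only; omega), mul_zero]
        _ ≤ _ := by
            rw [Finset.sum_ite_eq']
            split_ifs
            · exact le_rfl
            · positivity
    · refine (Finset.sum_eq_zero fun d _ => ?_).le
      rw [if_neg, mul_zero]
      rintro ⟨h3, h4, -⟩
      exact hx (Prod.ext h3.symm h4.symm)
  refine (Finset.sum_le_sum h2).trans ?_
  rw [Finset.sum_ite_eq']
  split_ifs
  · rw [add_comm]; simp
  · simp; positivity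

theorem sum_abs_topLaw_sub_le (hp : 0 ≤ p) (hq : 0 ≤ q) (hpq : p + 2 * q = 1)
    (A : Finset (ℤ × ℤ)) (r : ℕ) :
    (r : ℝ) ^ 2 * ∑ x ∈ A, ∑ m ∈ Finset.Icc (x.1 + r) (x.2 - r),
      |topLaw p q n σ x.1 x.2 (m + 1) - topLaw p q n σ x.1 x.2 (m - 1)| ≤ 8 * (1 + √n) := by
  rcases Nat.eq_zero_or_pos r with rfl | hr
  · simp; positivity
  refine le_trans ?_ (mul_le_mul_of_nonneg_left
    (sum_topLaw_le (σ := σ) (n := n) hp hq hpq A fun x => (x.2 - x.1).toNat + 2) (by norm_num))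
  rw [Finset.mul_sum, Finset.mul_sum]
  refine Finset.sum_le_sum fun x _ => ?_
  obtain ⟨a, b⟩ := x
  have h1 := sum_sq_mul_abs_sub_le (k := fun d => topLaw p q n σ a b (b - d))
    (g := fun d => topLaw p q n σ a b (b - d) / (d + 1))
    (fun d => by field_simp)
    (fun d => div_nonneg (topLaw_nonneg hp hq _ _ _) (by positivity))
    (fun d => by
      have := topLaw_ratio_anti (n := n) (σ := σ) hp hq a b d
      rw [div_le_div_iff₀ (by positivity) (by positivity)]
      push_cast
      rw [show b - ((d : ℤ) + 2) = b - d - 2 by ring]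
      linarith) (b - a).toNat
  refine le_trans ?_ h1
  dsimp only
  rw [Finset.mul_sum]
  -- With `d = b - m - 1` the sites `m + 1`, `m - 1` become `b - d`, `b - (d + 2)`, and `m ≤ b - r`
  -- gives `r ≤ d + 1`.
  have h2 : Set.InjOn (fun m : ℤ => (b - m - 1).toNat) (Finset.Icc (a + r) (b - r)) := by
    intro m hm m' hm' h
    simp only [Finset.coe_Icc, Set.mem_Icc] at hm hm' h
    omega
  calc _ ≤ ∑ m ∈ Finset.Icc (a + r) (b - r), (((b - m - 1).toNat : ℝ) + 1) ^ 2 *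
        |topLaw p q n σ a b (b - (b - m - 1).toNat) -
          topLaw p q n σ a b (b - ((b - m - 1).toNat + 2 : ℕ))| := by
        refine Finset.sum_le_sum fun m hm => ?_
        rw [Finset.mem_Icc] at hm
        have e : ((b - m - 1).toNat : ℤ) = b - m - 1 := Int.toNat_of_nonneg (by omega)
        push_cast
        rw [e, show b - (b - m - 1) = m + 1 by ring, show b - (b - m - 1 + 2) = m - 1 by ring]
        have : (r : ℝ) ≤ ((b - m - 1).toNat : ℝ) + 1 := by
          have : (r : ℤ) ≤ ((b - m - 1).toNat : ℤ) + 1 := by omega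
          exact_mod_cast this
        gcongr
    _ = ∑ d ∈ (Finset.Icc (a + r) (b - r)).image (fun m : ℤ => (b - m - 1).toNat),
        ((d : ℝ) + 1) ^ 2 * |topLaw p q n σ a b (b - d) - topLaw p q n σ a b (b - (d + 2 : ℕ))| := by
        rw [Finset.sum_image h2]
    _ ≤ _ := by
        refine Finset.sum_le_sum_of_subset_of_nonneg ?_ fun _ _ _ => by positivity
        intro d hd
        simp only [Finset.mem_image, Finset.mem_Icc, Finset.mem_range] at hd ⊢
        omega

theorem sum_abs_rangeLaw_two_step_le (hp : 0 ≤ p) (hq : 0 ≤ q) (hpq : p + 2 * q = 1)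
    (A : Finset (ℤ × ℤ)) (r : ℕ) :
    (r : ℝ) ^ 2 * ∑ x ∈ A, ∑ m ∈ Finset.Icc (x.1 + r) (x.2 - r),
      |rangeLaw p q n σ x.1 x.2 (m + 1) - rangeLaw p q n σ x.1 x.2 (m - 1)| ≤ 16 * (1 + √n) := by
  have h1 := sum_abs_topLaw_sub_le (n := n) (σ := σ) hp hq hpq A r
  have h2 := sum_abs_topLaw_sub_le (n := n) (σ := !σ) hp hq hpq
    (A.map ⟨fun x => (-x.2, -x.1), fun x y h => by
      simp only [Prod.mk.injEq, neg_inj] at h; exact Prod.ext h.2 h.1⟩) r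
  rw [Finset.sum_map] at h2
  have h3 : ∑ x ∈ A, ∑ m ∈ Finset.Icc (x.1 + r) (x.2 - r),
      |rangeLaw p q n σ x.1 x.2 (m + 1) - rangeLaw p q n σ x.1 x.2 (m - 1)| ≤
      ∑ x ∈ A, ∑ m ∈ Finset.Icc (x.1 + r) (x.2 - r),
        |topLaw p q n σ x.1 x.2 (m + 1) - topLaw p q n σ x.1 x.2 (m - 1)| +
      ∑ x ∈ A, ∑ m ∈ Finset.Icc (-x.2 + r) (-x.1 - r),
        |topLaw p q n (!σ) (-x.2) (-x.1) (m + 1) - topLaw p q n (!σ) (-x.2) (-x.1) (m - 1)| := by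
    rw [← Finset.sum_add_distrib]
    refine Finset.sum_le_sum fun x _ => ?_
    have e : ∑ m ∈ Finset.Icc (-x.2 + r) (-x.1 - r),
        |topLaw p q n (!σ) (-x.2) (-x.1) (m + 1) - topLaw p q n (!σ) (-x.2) (-x.1) (m - 1)| =
        ∑ m ∈ Finset.Icc (x.1 + r) (x.2 - r),
        |topLaw p q n (!σ) (-x.2) (-x.1) (-m + 1) - topLaw p q n (!σ) (-x.2) (-x.1) (-m - 1)| := by
      refine Finset.sum_nbij' (fun m => -m) (fun m => -m) ?_ ?_ ?_ ?_ ?_ <;> intro m hm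
      · simp only [Finset.mem_Icc] at hm ⊢; omega
      · simp only [Finset.mem_Icc] at hm ⊢; omega
      · simp
      · simp
      · simp
    rw [e, ← Finset.sum_add_distrib]
    refine Finset.sum_le_sum fun m _ => ?_
    rw [rangeLaw_eq_topLaw_add hp hq, rangeLaw_eq_topLaw_add hp hq,
      show -(m + 1) = -m - 1 by ring, show -(m - 1) = -m + 1 by ring, add_sub_add_comm,
      abs_sub_comm (topLaw p q n (!σ) (-x.2) (-x.1) (-m + 1))]
    exact abs_add_le _ _
  have h4 := mul_le_mul_of_nonneg_left h3 (show (0 : ℝ) ≤ (r : ℝ) ^ 2 by positivity)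
  rw [mul_add] at h4
  exact h4.trans ((add_le_add h1 h2).trans_eq (by ring))

theorem abs_sub_two_mul_lt_one (hp : 0 < p) (hq : 0 < q) (hpq : p + 2 * q = 1) :
    |p - 2 * q| < 1 := by
  rw [abs_lt]; constructor <;> linarith

/-- After a heat step, a one-step difference is `p - 2q` times the old one plus `q` times two
two-step differences. The factor is a contraction when `p, q > 0`; this is where laziness removes
parity. -/
theorem abs_step_sub_step_le (hq : 0 ≤ q) (x₀ x₁ x₂ x₃ : ℝ) :
    |p * x₂ + q * (x₁ + x₃) - (p * x₁ + q * (x₀ + x₂))| ≤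
      |p - 2 * q| * |x₂ - x₁| + q * (|x₂ - x₀| + |x₃ - x₁|) := by
  calc _ = |(p - 2 * q) * (x₂ - x₁) + q * ((x₂ - x₀) + (x₃ - x₁))| := by congr 1; ring
    _ ≤ |p - 2 * q| * |x₂ - x₁| + |q| * |(x₂ - x₀) + (x₃ - x₁)| := by
      rw [← abs_mul, ← abs_mul]; exact abs_add_le _ _
    _ ≤ _ := by
      rw [abs_of_nonneg hq]
      gcongr
      exact abs_add_le _ _

/-- With `θ = |p - 2q|`, the one- and two-step variations `Z`, `Y` satisfy `Z_{n+1} ≤ θ Z_n + 2q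
Y_n`. As `2q ≤ 1`, the bound on `Y` passes to `(1 - θ) Z`. -/
theorem sum_abs_rangeLaw_step_le (hp : 0 < p) (hq : 0 < q) (hpq : p + 2 * q = 1)
    (A : Finset (ℤ × ℤ)) {r : ℕ} (hr : 0 < r) :
    (1 - |p - 2 * q|) * ((r : ℝ) ^ 2 * ∑ x ∈ A, ∑ m ∈ Finset.Ico (x.1 + r) (x.2 - r),
      |rangeLaw p q n σ x.1 x.2 (m + 1) - rangeLaw p q n σ x.1 x.2 m|) ≤ 16 * (1 + √n) := by
  have hθ := abs_sub_two_mul_lt_one hp hq hpq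
  induction n with
  | zero =>
    have : ∑ x ∈ A, ∑ m ∈ Finset.Ico (x.1 + r) (x.2 - r),
      |rangeLaw p q 0 σ x.1 x.2 (m + 1) - rangeLaw p q 0 σ x.1 x.2 m| = 0 := by
      refine Finset.sum_eq_zero fun x _ => Finset.sum_eq_zero fun m hm => ?_
      rw [Finset.mem_Ico] at hm
      simp only [rangeLaw, expect_zero]
      rw [if_neg (by omega), if_neg (by omega)]; simp
    rw [this]; simp
  | succ n ih =>
    have h2 := sum_abs_rangeLaw_two_step_le (n := n) (σ := σ) hp.le hq.le hpq A r
    set Z := ∑ x ∈ A, ∑ m ∈ Finset.Ico (x.1 + r) (x.2 - r),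
      |rangeLaw p q n σ x.1 x.2 (m + 1) - rangeLaw p q n σ x.1 x.2 m| with hZ
    set Y := ∑ x ∈ A, ∑ m ∈ Finset.Icc (x.1 + r) (x.2 - r),
      |rangeLaw p q n σ x.1 x.2 (m + 1) - rangeLaw p q n σ x.1 x.2 (m - 1)| with hY
    have h3 : ∑ x ∈ A, ∑ m ∈ Finset.Ico (x.1 + r) (x.2 - r),
        |rangeLaw p q (n + 1) σ x.1 x.2 (m + 1) - rangeLaw p q (n + 1) σ x.1 x.2 m| ≤
        |p - 2 * q| * Z + 2 * q * Y := by
      rw [hZ, hY, Finset.mul_sum, Finset.mul_sum, ← Finset.sum_add_distrib]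
      refine Finset.sum_le_sum fun x _ => ?_
      set f : ℤ → ℝ := fun m =>
        |rangeLaw p q n σ x.1 x.2 (m + 1) - rangeLaw p q n σ x.1 x.2 (m - 1)| with hf
      have e1 : ∑ m ∈ Finset.Ico (x.1 + r) (x.2 - r), f m ≤
          ∑ m ∈ Finset.Icc (x.1 + r) (x.2 - r), f m :=
        Finset.sum_le_sum_of_subset_of_nonneg Finset.Ico_subset_Icc_self
          fun _ _ _ => abs_nonneg _
      have e2 : ∑ m ∈ Finset.Ico (x.1 + r) (x.2 - r), f (m + 1) ≤
          ∑ m ∈ Finset.Icc (x.1 + r) (x.2 - r), f m := by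
        refine (Finset.sum_map (Finset.Ico (x.1 + r) (x.2 - r)) (addRightEmbedding (1 : ℤ))
          f).symm.trans_le ?_
        refine Finset.sum_le_sum_of_subset_of_nonneg ?_ fun _ _ _ => abs_nonneg _
        intro m hm
        simp only [Finset.mem_map, Finset.mem_Ico, addRightEmbedding_apply] at hm
        rw [Finset.mem_Icc]; omega
      calc _ ≤ ∑ m ∈ Finset.Ico (x.1 + r) (x.2 - r), (|p - 2 * q| *
            |rangeLaw p q n σ x.1 x.2 (m + 1) - rangeLaw p q n σ x.1 x.2 m| +
            q * (f m + f (m + 1))) := by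
            refine Finset.sum_le_sum fun m hm => ?_
            rw [Finset.mem_Ico] at hm
            rw [rangeLaw_succ hp.le hq.le (by omega) (by omega),
              rangeLaw_succ hp.le hq.le (by omega) (by omega)]
            simp only [hf, add_sub_cancel_right]
            exact abs_step_sub_step_le hq.le _ _ _ _
        _ = |p - 2 * q| * ∑ m ∈ Finset.Ico (x.1 + r) (x.2 - r),
              |rangeLaw p q n σ x.1 x.2 (m + 1) - rangeLaw p q n σ x.1 x.2 m| +
            q * (∑ m ∈ Finset.Ico (x.1 + r) (x.2 - r), f m +
              ∑ m ∈ Finset.Ico (x.1 + r) (x.2 - r), f (m + 1)) := by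
            rw [Finset.sum_add_distrib, ← Finset.mul_sum, ← Finset.mul_sum, Finset.sum_add_distrib]
        _ ≤ _ := by
            have := mul_le_mul_of_nonneg_left (add_le_add e1 e2) hq.le
            linarith
    have h4 : √(n : ℝ) ≤ √((n + 1 : ℕ) : ℝ) := Real.sqrt_le_sqrt (by push_cast; linarith)
    have hθ0 := abs_nonneg (p - 2 * q)
    have hθ1 : 0 ≤ 1 - |p - 2 * q| := by linarith
    calc _ ≤ (1 - |p - 2 * q|) * ((r : ℝ) ^ 2 * (|p - 2 * q| * Z + 2 * q * Y)) := by gcongr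
      _ = |p - 2 * q| * ((1 - |p - 2 * q|) * ((r : ℝ) ^ 2 * Z)) +
          (1 - |p - 2 * q|) * (2 * q) * ((r : ℝ) ^ 2 * Y) := by ring
      _ ≤ |p - 2 * q| * (16 * (1 + √n)) + (1 - |p - 2 * q|) * 1 * (16 * (1 + √n)) := by
          gcongr
          linarith
      _ = 16 * (1 + √n) := by ring
      _ ≤ _ := by gcongr

end Chain

/-! ### Variation of the law of the lazy walk -/

section LazyWalk

variable {p q : ℝ} {n : ℕ} {σ : Bool}

theorem expect_pos_eq (m : ℤ) :
    expect p q n σ (fun s => if s.pos = m then 1 else 0) = lazyWalk p q n m := by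
  induction n generalizing m with
  | zero => simp [expect_zero, lazyWalk, eq_comm]
  | succ n ih =>
    have h : stepOp p q (fun s => if s.pos = m then 1 else 0) =
        p • (fun s => if s.pos = m then (1 : ℝ) else 0) +
          q • ((fun s => if s.pos = m - 1 then (1 : ℝ) else 0) +
            fun s => if s.pos = m + 1 then (1 : ℝ) else 0) := by
      ext s
      have h1 : ∀ e, (s.move e).pos = s.pos + e := by
        intro e; unfold move; split_ifs <;> rfl
      rw [stepOp_apply, h1, h1]
      simp only [Pi.add_apply, Pi.smul_apply, smul_eq_mul]
      congr 2
      congr 1 <;> congr 1 <;> apply propext <;> omega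
    rw [expect_succ, h, map_add, map_smul, map_smul, map_add, ih, ih, ih]
    rfl

theorem sum_lazyWalk_le_one (hp : 0 ≤ p) (hq : 0 ≤ q) (hpq : p + 2 * q = 1) (A : Finset ℤ) :
    ∑ m ∈ A, lazyWalk p q n m ≤ 1 := by
  simp only [← expect_pos_eq (σ := true), ← map_sum]
  refine le_trans ?_ (expect_const (n := n) (σ := true) hpq 1).le
  refine expect_mono hp hq fun s _ => ?_
  rw [Finset.sum_apply, Finset.sum_ite_eq]
  split_ifs <;> simp

/-- Two-step differences have constant sign on `m ≥ 0` and telescope to at most the return mass at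
`0` and `1`; symmetry doubles this. -/
theorem sum_abs_lazyWalk_two_step_le (hp : 0 ≤ p) (hq : 0 < q) (hpq : p + 2 * q = 1)
    (A : Finset ℤ) :
    q * √n * ∑ m ∈ A, |lazyWalk p q n (m + 1) - lazyWalk p q n (m - 1)| ≤ 2 := by
  set f : ℤ → ℝ := fun m => |lazyWalk p q n (m + 1) - lazyWalk p q n (m - 1)| with hf
  have hneg : ∀ m, f (-m) = f m := by
    intro m
    simp only [hf]
    rw [show -m + 1 = -(m - 1) by ring, show -m - 1 = -(m + 1) by ring, lazyWalk_neg, lazyWalk_neg,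
      abs_sub_comm]
  have h1 : ∀ M : ℕ, ∑ d ∈ Finset.range M, f d ≤ lazyWalk p q n 0 + lazyWalk p q n 1 := by
    intro M
    have : ∑ d ∈ Finset.range M, f d = lazyWalk p q n 0 + lazyWalk p q n 1 -
        (lazyWalk p q n M + lazyWalk p q n (M - 1)) := by
      induction M with
      | zero => simp [lazyWalk_neg]
      | succ M ih =>
        rw [Finset.sum_range_succ, ih]
        have := lazyWalk_add_two_le (n := n) hp hq.le (m := (M : ℤ) - 1) (by omega)
        rw [show (M : ℤ) - 1 + 2 = M + 1 by ring] at this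
        simp only [hf]
        rw [abs_of_nonpos (by linarith)]
        push_cast
        rw [add_sub_cancel_right]
        ring
    rw [this]
    have := lazyWalk_nonneg (n := n) hp hq.le M
    have := lazyWalk_nonneg (n := n) hp hq.le (M - 1)
    linarith
  obtain ⟨M, hM⟩ : ∃ M : ℕ, ∀ m ∈ A, m.natAbs < M := by
    refine ⟨A.sup Int.natAbs + 1, fun m hm => Nat.lt_succ_of_le (Finset.le_sup (f := Int.natAbs) hm)⟩
  have h2 : ∑ m ∈ A, f m ≤ 2 * (lazyWalk p q n 0 + lazyWalk p q n 1) := by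
    have hsub : A ⊆ (Finset.range M).image (fun d : ℕ => (d : ℤ)) ∪
        (Finset.range M).image (fun d : ℕ => -(d : ℤ)) := by
      intro m hm
      have := hM m hm
      simp only [Finset.mem_union, Finset.mem_image, Finset.mem_range]
      rcases le_total 0 m with h | h
      · exact Or.inl ⟨m.natAbs, this, by omega⟩
      · exact Or.inr ⟨m.natAbs, this, by omega⟩
    have h3 := Finset.sum_le_sum_of_subset_of_nonneg hsub (f := f) fun _ _ _ => abs_nonneg _
    have h4 := Finset.sum_union_inter (s₁ := (Finset.range M).image (fun d : ℕ => (d : ℤ)))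
      (s₂ := (Finset.range M).image (fun d : ℕ => -(d : ℤ))) (f := f)
    have h5 : 0 ≤ ∑ m ∈ (Finset.range M).image (fun d : ℕ => (d : ℤ)) ∩
      (Finset.range M).image (fun d : ℕ => -(d : ℤ)), f m := Finset.sum_nonneg fun _ _ => abs_nonneg _
    rw [Finset.sum_image (by intro x _ y _ h; simpa using h),
      Finset.sum_image (by intro x _ y _ h; simpa using h)] at h4
    simp only [hneg] at h4
    have := h1 M
    linarith
  have h3 := lazyWalk_return_le (n := n) hp hq hpq
  calc _ ≤ q * √n * (2 * (lazyWalk p q n 0 + lazyWalk p q n 1)) := by gcongr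
    _ ≤ 2 := by linarith

/-- The contraction argument again, for use when `F` is trivial. The crude bound `2` on the
variation absorbs the growth of the weight from `n` to `n + 1`. -/
theorem sum_abs_lazyWalk_step_le (hp : 0 < p) (hq : 0 < q) (hpq : p + 2 * q = 1)
    (A : Finset ℤ) :
    (1 - |p - 2 * q|) * (n * ∑ m ∈ A, |lazyWalk p q n (m + 1) - lazyWalk p q n m|) ≤
      10 * (1 + √n) := by
  have hθ := abs_sub_two_mul_lt_one hp hq hpq
  have hθ0 := abs_nonneg (p - 2 * q)
  have hθ1 : 0 ≤ 1 - |p - 2 * q| := by linarith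
  have h2 : ∀ n, ∑ m ∈ A, |lazyWalk p q n (m + 1) - lazyWalk p q n m| ≤ 2 := by
    intro n
    have e1 := sum_lazyWalk_le_one (n := n) hp.le hq.le hpq A
    have e2 := sum_lazyWalk_le_one (n := n) hp.le hq.le hpq (A.map (addRightEmbedding 1))
    rw [Finset.sum_map] at e2
    have e3 : ∑ m ∈ A, |lazyWalk p q n (m + 1) - lazyWalk p q n m| ≤
        ∑ m ∈ A, (lazyWalk p q n (m + 1) + lazyWalk p q n m) := by
      refine Finset.sum_le_sum fun m _ => ?_
      have := lazyWalk_nonneg (n := n) hp.le hq.le m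
      have := lazyWalk_nonneg (n := n) hp.le hq.le (m + 1)
      rw [abs_le]; constructor <;> linarith
    rw [Finset.sum_add_distrib] at e3
    simp only [addRightEmbedding_apply] at e2
    linarith
  induction n with
  | zero => simp
  | succ n ih =>
    set Z := ∑ m ∈ A, |lazyWalk p q n (m + 1) - lazyWalk p q n m| with hZ
    have h4 : √(n : ℝ) ≤ √((n + 1 : ℕ) : ℝ) := Real.sqrt_le_sqrt (by push_cast; linarith)
    rcases Nat.eq_zero_or_pos n with rfl | hn
    · have := h2 (0 + 1)
      have h5 : (1 - |p - 2 * q|) * (((0 + 1 : ℕ) : ℝ) * ∑ m ∈ A,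
          |lazyWalk p q (0 + 1) (m + 1) - lazyWalk p q (0 + 1) m|) ≤ 1 * (((0 + 1 : ℕ) : ℝ) * 2) := by
        gcongr
        linarith
      refine h5.trans ?_
      norm_num
    have e1 := sum_abs_lazyWalk_two_step_le (n := n) hp.le hq hpq A
    have e2 := sum_abs_lazyWalk_two_step_le (n := n) hp.le hq hpq (A.map (addRightEmbedding 1))
    rw [Finset.sum_map] at e2
    simp only [addRightEmbedding_apply, add_sub_cancel_right] at e2
    set D₁ := ∑ m ∈ A, |lazyWalk p q n (m + 1) - lazyWalk p q n (m - 1)|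
    set D₂ := ∑ m ∈ A, |lazyWalk p q n (m + 1 + 1) - lazyWalk p q n m|
    have h3 : ∑ m ∈ A, |lazyWalk p q (n + 1) (m + 1) - lazyWalk p q (n + 1) m| ≤
        |p - 2 * q| * Z + q * (D₁ + D₂) := by
      rw [hZ, ← Finset.sum_add_distrib, Finset.mul_sum, Finset.mul_sum, ← Finset.sum_add_distrib]
      refine Finset.sum_le_sum fun m _ => ?_
      rw [lazyWalk, lazyWalk, add_sub_cancel_right]
      exact abs_step_sub_step_le hq.le _ _ _ _
    have hn1 : (1 : ℝ) ≤ n := by exact_mod_cast hn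
    have hD : (n + 1) * (q * (D₁ + D₂)) ≤ 8 * √n := by
      have hsq : √(n : ℝ) * √n = n := Real.mul_self_sqrt (by positivity)
      have hD0 : 0 ≤ q * (D₁ + D₂) := mul_nonneg hq.le (add_nonneg
        (Finset.sum_nonneg fun _ _ => abs_nonneg _) (Finset.sum_nonneg fun _ _ => abs_nonneg _))
      calc (n + 1) * (q * (D₁ + D₂)) ≤ (2 * (√n * √n)) * (q * (D₁ + D₂)) := by
            rw [hsq]; gcongr; linarith
        _ = 2 * √n * (q * √n * D₁ + q * √n * D₂) := by ring
        _ ≤ 2 * √n * (2 + 2) := by gcongr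
        _ = 8 * √n := by ring
    have hZ2 : |p - 2 * q| * Z ≤ 1 * 2 := by
      have hZ0 : 0 ≤ Z := Finset.sum_nonneg fun _ _ => abs_nonneg _
      have := h2 n
      gcongr
    calc _ ≤ (1 - |p - 2 * q|) * (((n + 1 : ℕ) : ℝ) * (|p - 2 * q| * Z + q * (D₁ + D₂))) := by gcongr
      _ = |p - 2 * q| * ((1 - |p - 2 * q|) * (n * Z)) +
          (1 - |p - 2 * q|) * (|p - 2 * q| * Z + (n + 1) * (q * (D₁ + D₂))) := by push_cast; ring
      _ ≤ |p - 2 * q| * (10 * (1 + √n)) + (1 - |p - 2 * q|) * (1 * 2 + 8 * √n) := by gcongr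
      _ ≤ |p - 2 * q| * (10 * (1 + √n)) + (1 - |p - 2 * q|) * (10 * (1 + √n)) := by
          have := Real.sqrt_nonneg (n : ℝ)
          gcongr
          linarith
      _ = 10 * (1 + √n) := by ring
      _ ≤ _ := by gcongr

end LazyWalk

/-! ### Convolutions, and idempotence of the uniform law -/

section Convolution

variable {G : Type*} [Group G]

theorem pmfConv_assoc (ξ η ζ : PMF G) :
    pmfConv (pmfConv ξ η) ζ = pmfConv ξ (pmfConv η ζ) := by
  simp only [pmfConv, PMF.bind_bind, PMF.map, PMF.pure_bind, Function.comp_def, mul_assoc]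

theorem pmfConv_map_apply {β : Type*} (ξ : PMF G) (η : PMF β) (f : β → G) (h : G) :
    pmfConv ξ (η.map f) h = ∑' b, η b * ξ (h * (f b)⁻¹) := by
  have h1 : pmfConv ξ (η.map f) = η.bind fun b => ξ.map fun x => x * f b := by
    simp only [pmfConv, PMF.map, PMF.bind_bind, PMF.pure_bind, Function.comp_def]
    rw [PMF.bind_comm]
  rw [h1, PMF.bind_apply]
  refine tsum_congr fun b => ?_
  rw [PMF.map_apply, tsum_eq_single (h * (f b)⁻¹)]
  · simp
  · intro x hx
    rw [if_neg]
    rintro rfl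
    simp at hx

theorem pmfConv_one_left (ξ : PMF G) : pmfConv (PMF.pure 1) ξ = ξ := by
  rw [pmfConv, PMF.pure_bind]
  simp only [one_mul]
  exact PMF.map_id ξ

theorem uniformOfFintype_map_mul_left [Fintype G] (b : G) :
    (PMF.uniformOfFintype G).map (fun x => b * x) = PMF.uniformOfFintype G := by
  ext x
  rw [PMF.map_apply, tsum_eq_single (b⁻¹ * x)]
  · simp
  · intro y hy
    rw [if_neg]
    rintro rfl
    simp at hy

theorem pmfConv_uniform_map [Fintype G] {H : Type*} [Group H] (f : G → H)
    (hf : ∀ a b, f (a * b) = f a * f b) :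
    pmfConv ((PMF.uniformOfFintype G).map f) ((PMF.uniformOfFintype G).map f) =
      (PMF.uniformOfFintype G).map f := by
  have : ∀ b, ((PMF.uniformOfFintype G).map f).map (fun y => f b * y) =
      (PMF.uniformOfFintype G).map f := by
    intro b
    conv_rhs => rw [← uniformOfFintype_map_mul_left b]
    rw [PMF.map_comp, PMF.map_comp]
    congr 1
    ext x
    simp [hf]
  rw [pmfConv]
  conv_lhs => enter [1]; rw [PMF.map]
  rw [PMF.bind_bind]
  simp only [Function.comp_apply, PMF.pure_bind, this, PMF.bind_const]

end Convolution

/-! ### The law of the lamp configuration -/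

section Wreath

variable {F : Type*} [Group F]

local notation "𝓖" => WreathProduct (Multiplicative ℤ) F

theorem lampAtOne_one (b : F) : (lampAtOne (Multiplicative ℤ) b).1 1 = b := by
  exact @Pi.mulSingle_eq_same (Multiplicative ℤ) (fun _ => F) _
    (fun a b => Classical.propDecidable (a = b)) 1 b

theorem lampAtOne_of_ne (b : F) {x : Multiplicative ℤ} (hx : x ≠ 1) :
    (lampAtOne (Multiplicative ℤ) b).1 x = 1 := by
  exact @Pi.mulSingle_eq_of_ne (Multiplicative ℤ) (fun _ => F) _
    (fun a b => Classical.propDecidable (a = b)) _ _ hx b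

theorem lampAtOne_mul (b b' : F) : lampAtOne (Multiplicative ℤ) (b * b') =
    lampAtOne (Multiplicative ℤ) b * lampAtOne (Multiplicative ℤ) b' := by
  refine Subtype.ext (funext fun x => ?_)
  rw [Subgroup.coe_mul, Pi.mul_apply]
  by_cases h : x = 1
  · subst h; rw [lampAtOne_one, lampAtOne_one, lampAtOne_one]
  · rw [lampAtOne_of_ne _ h, lampAtOne_of_ne _ h, lampAtOne_of_ne _ h, one_mul]

theorem mul_inl_lampAtOne_inv_left (h : 𝓖) (b : F) (x : Multiplicative ℤ) :
    (h * (SemidirectProduct.inl (lampAtOne (Multiplicative ℤ) b) : 𝓖)⁻¹).left.1 x =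
      if x = h.right then h.left.1 x * b⁻¹ else h.left.1 x := by
  have : (h * (SemidirectProduct.inl (lampAtOne (Multiplicative ℤ) b) : 𝓖)⁻¹).left.1 x =
      h.left.1 x * ((lampAtOne (Multiplicative ℤ) b).1 (h.right⁻¹ * x))⁻¹ := by
    rw [← map_inv]; rfl
  rw [this]
  split_ifs with hx
  · subst hx; rw [inv_mul_cancel, lampAtOne_one]
  · rw [lampAtOne_of_ne, inv_one, mul_one]
    intro h'
    exact hx (inv_mul_eq_one.1 h').symm

/-- The position of the walker. -/
def walkerPos (h : 𝓖) : ℤ := Multiplicative.toAdd h.right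

/-- All lamps in the configuration of `h` are located in `[a, b]`. -/
def LampsIn (h : 𝓖) (a b : ℤ) : Prop :=
  ∀ x : ℤ, h.left.1 (Multiplicative.ofAdd x) ≠ 1 → a ≤ x ∧ x ≤ b

open Classical in
/-- The probability of `h`, if the walker is in state `s` and the lamps in the visited interval are
independent and uniform. -/
def lampDensity [Fintype F] (h : 𝓖) (s : RangeState) : ℝ :=
  if s.pos = walkerPos h ∧ LampsIn h s.lo s.hi then
    ((Fintype.card F : ℝ)⁻¹) ^ (s.hi - s.lo + 1).toNat else 0

/-- The last move and switch are undone. At a visited site a uniform switch changes nothing; at a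
new site the switch is forced, and its probability is the factor for the added site. -/
theorem sum_lampDensity [Fintype F] (h : 𝓖) {n : ℕ} {s : RangeState} (hs : s.InRange n) {e : ℤ}
    (he : e = 0 ∨ e = 1 ∨ e = -1) :
    ∑ b : F, (Fintype.card F : ℝ)⁻¹ * lampDensity
      (h * (SemidirectProduct.inl (lampAtOne (Multiplicative ℤ) b) : 𝓖)⁻¹ *
        (SemidirectProduct.inr (Multiplicative.ofAdd e) : 𝓖)⁻¹) s = lampDensity h (s.move e) := by
  classical
  obtain ⟨h1, h2, h3, h4⟩ := hs
  have hF : (Fintype.card F : ℝ) ≠ 0 := by exact_mod_cast Fintype.card_ne_zero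
  have hpos : (s.move e).pos = s.pos + e := by unfold move; split_ifs <;> rfl
  have hw : ∀ b : F, walkerPos (h * (SemidirectProduct.inl (lampAtOne (Multiplicative ℤ) b) : 𝓖)⁻¹ *
      (SemidirectProduct.inr (Multiplicative.ofAdd e) : 𝓖)⁻¹) = walkerPos h - e := by
    intro b
    simp [walkerPos, ← map_inv, sub_eq_add_neg]
  have hl : ∀ b : F, ∀ x : ℤ, (h * (SemidirectProduct.inl (lampAtOne (Multiplicative ℤ) b) : 𝓖)⁻¹ *
      (SemidirectProduct.inr (Multiplicative.ofAdd e) : 𝓖)⁻¹).left.1 (Multiplicative.ofAdd x) =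
      if x = walkerPos h then h.left.1 (Multiplicative.ofAdd x) * b⁻¹
        else h.left.1 (Multiplicative.ofAdd x) := by
    intro b x
    have e1 : (h * (SemidirectProduct.inl (lampAtOne (Multiplicative ℤ) b) : 𝓖)⁻¹ *
      (SemidirectProduct.inr (Multiplicative.ofAdd e) : 𝓖)⁻¹).left =
      (h * (SemidirectProduct.inl (lampAtOne (Multiplicative ℤ) b) : 𝓖)⁻¹).left := by
      rw [← map_inv SemidirectProduct.inr, SemidirectProduct.mul_left, SemidirectProduct.left_inr,
        map_one, mul_one]
    rw [e1, mul_inl_lampAtOne_inv_left]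
    rfl
  by_cases hm : s.pos + e = walkerPos h
  swap
  · rw [lampDensity, if_neg (by rw [hpos]; exact fun h' => hm h'.1)]
    refine Finset.sum_eq_zero fun b _ => ?_
    rw [lampDensity, if_neg, mul_zero]
    rw [hw]
    intro h'
    exact hm (by linarith [h'.1])
  have hm' : s.pos = walkerPos h - e := by omega
  simp only [lampDensity, hpos, hw, hm', sub_add_cancel, true_and]
  set m := walkerPos h with hmdef
  by_cases hin : s.lo ≤ m ∧ m ≤ s.hi
  · have hmv : (s.move e).lo = s.lo ∧ (s.move e).hi = s.hi := by
      unfold move; rw [if_neg (by omega), if_neg (by omega)]; exact ⟨rfl, rfl⟩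
    have hiff : ∀ b : F, LampsIn (h * (SemidirectProduct.inl (lampAtOne (Multiplicative ℤ) b) : 𝓖)⁻¹ *
      (SemidirectProduct.inr (Multiplicative.ofAdd e) : 𝓖)⁻¹) s.lo s.hi ↔ LampsIn h s.lo s.hi := by
      intro b
      unfold LampsIn
      simp only [hl]
      refine forall_congr' fun x => ?_
      split_ifs with hx
      · subst hx; simp [hin]
      · rfl
    simp only [hiff, hmv.1, hmv.2]
    rw [Finset.sum_const, Finset.card_univ, nsmul_eq_mul, ← mul_assoc, mul_inv_cancel₀ hF, one_mul]
  -- Before the switch the lamp at the new site `m` was trivial, so `b` is the lamp of `h` there.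
  · have hiff : ∀ b : F, LampsIn (h * (SemidirectProduct.inl (lampAtOne (Multiplicative ℤ) b) : 𝓖)⁻¹ *
      (SemidirectProduct.inr (Multiplicative.ofAdd e) : 𝓖)⁻¹) s.lo s.hi ↔
        b = h.left.1 (Multiplicative.ofAdd m) ∧ LampsIn h (s.move e).lo (s.move e).hi := by
      intro b
      have hmv : ∀ x, ((s.move e).lo ≤ x ∧ x ≤ (s.move e).hi) ↔ (x = m ∨ s.lo ≤ x ∧ x ≤ s.hi) := by
        intro x
        unfold move
        split_ifs <;> simp only <;> omega
      unfold LampsIn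
      simp only [hl, hmv]
      constructor
      · intro hx
        constructor
        · by_contra hb
          have := hx m
          rw [if_pos rfl] at this
          exact hin (this fun h' => hb (mul_inv_eq_one.1 h').symm)
        · intro x hx'
          by_cases hxm : x = m
          · exact Or.inl hxm
          · have := hx x
            rw [if_neg hxm] at this
            exact Or.inr (this hx')
      · rintro ⟨rfl, hx⟩ x hx'
        split_ifs at hx' with hxm
        · subst hxm; simp at hx'
        · exact (hx x hx').resolve_left hxm
    have hlen : ((s.move e).hi - (s.move e).lo + 1).toNat = (s.hi - s.lo + 1).toNat + 1 := by
      unfold move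
      split_ifs <;> simp only <;> omega
    simp only [hiff, hlen, ite_and, mul_ite, mul_zero]
    rw [Finset.sum_ite_eq' Finset.univ, if_pos (Finset.mem_univ _), pow_succ, mul_comm]

theorem card_lampsIn_le [Fintype F] (H : Finset 𝓖) (m a b : ℤ)
    (hH : ∀ h ∈ H, walkerPos h = m ∧ LampsIn h a b) :
    H.card ≤ Fintype.card F ^ (b - a + 1).toNat := by
  classical
  have h1 : H.card ≤ (Finset.univ : Finset (Finset.Icc a b → F)).card := by
    refine Finset.card_le_card_of_injOn (fun h x => h.left.1 (Multiplicative.ofAdd x.1))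
      (fun _ _ => Finset.mem_coe.2 (Finset.mem_univ _)) ?_
    intro h hh h' hh' heq
    obtain ⟨e1, e2⟩ := hH h hh
    obtain ⟨e1', e2'⟩ := hH h' hh'
    refine SemidirectProduct.ext (Subtype.ext (funext fun x => ?_)) ?_
    · by_cases hx : a ≤ Multiplicative.toAdd x ∧ Multiplicative.toAdd x ≤ b
      · exact congrFun heq ⟨Multiplicative.toAdd x, Finset.mem_Icc.2 hx⟩
      · have e3 := not_imp_comm.1 (e2 (Multiplicative.toAdd x)) hx
        have e3' := not_imp_comm.1 (e2' (Multiplicative.toAdd x)) hx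
        exact e3.trans e3'.symm
    · exact Multiplicative.toAdd.injective (e1.trans e1'.symm)
  rw [Finset.card_univ, Fintype.card_fun, Fintype.card_coe, Int.card_Icc] at h1
  rwa [show b - a + 1 = b + 1 - a by ring]

theorem toReal_pmfConv_uniform {G : Type*} [Group G] [Fintype F] (ξ : PMF G) (f : F → G) (h : G) :
    (pmfConv ξ ((PMF.uniformOfFintype F).map f) h).toReal =
      ∑ b : F, (Fintype.card F : ℝ)⁻¹ * (ξ (h * (f b)⁻¹)).toReal := by
  rw [pmfConv_map_apply, tsum_fintype, ENNReal.toReal_sum]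
  · refine Finset.sum_congr rfl fun b _ => ?_
    rw [ENNReal.toReal_mul, PMF.uniformOfFintype_apply, ENNReal.toReal_inv, ENNReal.toReal_natCast]
  · intro b _
    exact ENNReal.mul_ne_top (PMF.apply_ne_top _ _) (PMF.apply_ne_top _ _)

theorem toReal_pmfConv_three {G : Type*} [Group G] (ξ : PMF G) (ν : PMF (Multiplicative ℤ))
    (hν : ν.support ⊆ Multiplicative.ofAdd '' ({-1, 0, 1} : Set ℤ)) (f : Multiplicative ℤ → G)
    (h : G) :
    (pmfConv ξ (ν.map f) h).toReal =
      (ν (Multiplicative.ofAdd 0)).toReal * (ξ (h * (f (Multiplicative.ofAdd 0))⁻¹)).toReal +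
      ((ν (Multiplicative.ofAdd 1)).toReal * (ξ (h * (f (Multiplicative.ofAdd 1))⁻¹)).toReal +
      (ν (Multiplicative.ofAdd (-1))).toReal * (ξ (h * (f (Multiplicative.ofAdd (-1)))⁻¹)).toReal) := by
  rw [pmfConv_map_apply, tsum_eq_sum (s := ({0, 1, -1} : Finset ℤ).map
    Multiplicative.ofAdd.toEmbedding), Finset.sum_map, ENNReal.toReal_sum]
  · simp [ENNReal.toReal_mul]
  · intro b _
    exact ENNReal.mul_ne_top (PMF.apply_ne_top _ _) (PMF.apply_ne_top _ _)
  · intro b hb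
    have : ν b = 0 := by
      by_contra h0
      obtain ⟨x, hx, rfl⟩ := hν ((PMF.mem_support_iff _ _).2 h0)
      refine hb ?_
      simp only [Set.mem_insert_iff, Set.mem_singleton_iff] at hx
      rw [Finset.mem_map_equiv]
      simp
      tauto
    rw [this, zero_mul]

theorem pmfConv_one_inl_lampAtOne [Fintype F] (h : 𝓖) (σ : Bool) :
    (pmfConv (PMF.pure 1) ((PMF.uniformOfFintype F).map fun b =>
      (SemidirectProduct.inl (lampAtOne (Multiplicative ℤ) b) : 𝓖)) h).toReal =
      lampDensity h ⟨0, 0, 0, σ⟩ := by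
  classical
  rw [toReal_pmfConv_uniform, lampDensity]
  have h1 : ∀ b : F, h * (SemidirectProduct.inl (lampAtOne (Multiplicative ℤ) b) : 𝓖)⁻¹ = 1 ↔
      b = h.left.1 1 ∧ ((0 : ℤ) = walkerPos h ∧ LampsIn h 0 0) := by
    intro b
    rw [mul_inv_eq_one]
    constructor
    · rintro rfl
      refine ⟨(lampAtOne_one b).symm, rfl, fun x hx => ?_⟩
      by_contra h0
      refine hx (lampAtOne_of_ne b fun h' => h0 ?_)
      have : x = 0 := h'
      omega
    · rintro ⟨rfl, h2, h3⟩
      refine SemidirectProduct.ext (Subtype.ext (funext fun x => ?_)) ?_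
      · by_cases hx : x = 1
        · subst hx; exact (lampAtOne_one _).symm
        · refine Eq.trans ?_ (lampAtOne_of_ne _ hx).symm
          by_contra h4
          have := h3 (Multiplicative.toAdd x) h4
          exact hx (Multiplicative.toAdd.injective (show Multiplicative.toAdd x = 0 by omega))
      · exact Multiplicative.toAdd.injective h2.symm
  simp only [PMF.pure_apply, h1]
  simp only [ite_and, apply_ite ENNReal.toReal, ENNReal.toReal_one, ENNReal.toReal_zero, mul_ite,
    mul_one, mul_zero]
  rw [Finset.sum_ite_eq' Finset.univ, if_pos (Finset.mem_univ _)]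
  simp

/-- Time `0` is excluded because no switch has then been made at the origin. -/
theorem exists_stepProb_eq_expect [Fintype F] {μ : PMF 𝓖}
    (hμ : IsStandardSimpleSwitchWalkSwitch μ) :
    ∃ p q : ℝ, 0 < p ∧ 0 < q ∧ p + 2 * q = 1 ∧
      ∀ n, 0 < n → ∀ h, stepProb μ n h = expect p q n true (lampDensity h) := by
  obtain ⟨ν, hsymm, hsupp, hμ⟩ := hμ
  set U : PMF 𝓖 := (PMF.uniformOfFintype F).map fun b =>
    (SemidirectProduct.inl (lampAtOne (Multiplicative ℤ) b) : 𝓖) with hU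
  set N : PMF 𝓖 := ν.map fun a => (SemidirectProduct.inr a : 𝓖) with hN
  have hpos : ∀ x : ℤ, x = 0 ∨ x = 1 ∨ x = -1 → 0 < (ν (Multiplicative.ofAdd x)).toReal := by
    intro x hx
    refine ENNReal.toReal_pos ?_ (PMF.apply_ne_top _ _)
    rw [← PMF.mem_support_iff, hsupp]
    refine ⟨x, ?_, rfl⟩
    simp only [Set.mem_insert_iff, Set.mem_singleton_iff]
    tauto
  have hν1 : ν (Multiplicative.ofAdd (-1)) = ν (Multiplicative.ofAdd 1) := by
    rw [ofAdd_neg]; exact hsymm _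
  refine ⟨(ν (Multiplicative.ofAdd 0)).toReal, (ν (Multiplicative.ofAdd 1)).toReal,
    hpos _ (by simp), hpos _ (by simp), ?_, ?_⟩
  -- Total mass of `ν`, read off from its image under the constant map to `1`.
  · have h1 := toReal_pmfConv_three (PMF.pure (1 : 𝓖)) ν hsupp.subset (fun _ => 1) 1
    rw [hν1, pmfConv_one_left] at h1
    have h2 : (ν.map fun _ => (1 : 𝓖)) 1 = 1 := by
      exact (congrArg (fun ξ : PMF 𝓖 => ξ 1) (PMF.map_const ν (1 : 𝓖))).trans (by simp)
    rw [h2] at h1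
    simp only [inv_one, mul_one, PMF.pure_apply, if_true, ENNReal.toReal_one] at h1
    linarith
  set p := (ν (Multiplicative.ofAdd 0)).toReal with hp
  set q := (ν (Multiplicative.ofAdd 1)).toReal with hq
  have hp0 : 0 ≤ p := ENNReal.toReal_nonneg
  have hq0 : 0 ≤ q := ENNReal.toReal_nonneg
  have hUU : pmfConv U U = U := by
    refine pmfConv_uniform_map _ fun a b => ?_
    rw [lampAtOne_mul, map_mul]
  have hμ' : μ = pmfConv (pmfConv U N) U := hμ
  have hμU : pmfConv μ U = μ := by rw [hμ', pmfConv_assoc, hUU]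
  -- The appended switch makes the formula hold from `n = 0`; for `n ≥ 1` it is absorbed by the last
  -- factor of `μ`.
  have key : ∀ n h, (pmfConv (pmfConvPow μ n) U h).toReal = expect p q n true (lampDensity h) := by
    intro n
    induction n with
    | zero =>
      intro h
      exact pmfConv_one_inl_lampAtOne h true
    | succ n ih =>
      intro h
      have h1 : pmfConv (pmfConvPow μ (n + 1)) U =
          pmfConv (pmfConv (pmfConv (pmfConvPow μ n) U) N) U := by
        rw [pmfConvPow, pmfConv_assoc, hμU]
        calc _ = pmfConv (pmfConvPow μ n) (pmfConv (pmfConv U N) U) := by rw [← hμ']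
          _ = _ := by simp only [pmfConv_assoc]
      rw [h1, toReal_pmfConv_uniform, expect_succ]
      simp only [hN, toReal_pmfConv_three _ ν hsupp.subset, ih, hν1]
      rw [← hp, ← hq]
      simp only [← smul_eq_mul (a := (_ : ℝ)), ← map_smul, ← map_add, ← map_sum]
      refine expect_congr hp0 hq0 fun s hs => ?_
      have hs0 : s.move 0 = s := by
        obtain ⟨h1, h2, h3, h4⟩ := hs
        unfold move
        rw [if_neg (by omega), if_neg (by omega), add_zero]
      rw [stepOp_apply]
      have e0 := sum_lampDensity h hs (e := 0) (by simp)
      rw [hs0] at e0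
      rw [← e0, ← sum_lampDensity h hs (e := 1) (by simp),
        ← sum_lampDensity h hs (e := -1) (by simp)]
      simp only [Finset.sum_apply, Pi.add_apply, Pi.smul_apply, smul_eq_mul, Finset.mul_sum,
        ← Finset.sum_add_distrib]
      refine Finset.sum_congr rfl fun b _ => ?_
      ring
  intro n hn h
  obtain ⟨n, rfl⟩ := Nat.exists_eq_succ_of_ne_zero hn.ne'
  rw [← key, stepProb, Nat.succ_eq_add_one, pmfConvPow, pmfConv_assoc, hμU]

/-! ### Lamp changes near the walker -/

/-- The element of `ℤ ≀ F` that moves the walker by `k`. -/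
def walk (k : ℤ) : 𝓖 := SemidirectProduct.inr (Multiplicative.ofAdd k)

theorem walkerPos_mul (h g : 𝓖) : walkerPos (h * g) = walkerPos h + walkerPos g := by
  simp [walkerPos]

theorem walkerPos_walk (k : ℤ) : walkerPos (walk k : 𝓖) = k := rfl

theorem mul_left_apply (h g : 𝓖) (x : ℤ) : (h * g).left.1 (Multiplicative.ofAdd x) =
    h.left.1 (Multiplicative.ofAdd x) * g.left.1 (Multiplicative.ofAdd (x - walkerPos h)) := by
  have : (h * g).left.1 (Multiplicative.ofAdd x) = h.left.1 (Multiplicative.ofAdd x) *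
      g.left.1 (h.right⁻¹ * Multiplicative.ofAdd x) := rfl
  rw [this]
  exact congrArg (fun y : ℤ => _ * g.left.1 (Multiplicative.ofAdd y))
    (neg_add_eq_sub (walkerPos h) x)

theorem lampsIn_mul_walk (h : 𝓖) (k a b : ℤ) : LampsIn (h * walk k) a b ↔ LampsIn h a b := by
  have : ∀ x : ℤ, (walk k : 𝓖).left.1 (Multiplicative.ofAdd x) = 1 := fun _ => rfl
  simp only [LampsIn, mul_left_apply, this, mul_one]

theorem LampsIn.mul {h g : 𝓖} {K M : ℤ} (hh : LampsIn h (-K) K) (hh' : |walkerPos h| ≤ K)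
    (hg : LampsIn g (-M) M) (hM : 0 ≤ M) : LampsIn (h * g) (-(K + M)) (K + M) := by
  intro x hx
  rw [mul_left_apply] at hx
  rw [abs_le] at hh'
  by_cases h1 : h.left.1 (Multiplicative.ofAdd x) = 1
  · rw [h1, one_mul] at hx
    have := hg _ hx
    omega
  · have := hh _ h1
    omega

/-- There are nontrivial lamps at distance at least `r` from the walker, on both sides. -/
def LampsBeyond (h : 𝓖) (r : ℕ) : Prop :=
  (∃ x : ℤ, x ≤ walkerPos h - r ∧ h.left.1 (Multiplicative.ofAdd x) ≠ 1) ∧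
    ∃ x : ℤ, walkerPos h + r ≤ x ∧ h.left.1 (Multiplicative.ofAdd x) ≠ 1

/-- The far lamps on both sides are untouched, and an interval containing both contains the whole
window where lamps change. -/
theorem LampsBeyond.lampsIn_mul_iff {h g : 𝓖} {r : ℕ} {K : ℤ} (hh : LampsBeyond h r)
    (hg : LampsIn g (-K) K) (hK : K < r) (a b : ℤ) : LampsIn (h * g) a b ↔ LampsIn h a b := by
  obtain ⟨⟨y, hy, hy'⟩, ⟨z, hz, hz'⟩⟩ := hh
  have hfar : ∀ x : ℤ, (x < walkerPos h - K ∨ walkerPos h + K < x) →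
      (h * g).left.1 (Multiplicative.ofAdd x) = h.left.1 (Multiplicative.ofAdd x) := by
    intro x hx
    rw [mul_left_apply]
    by_cases h1 : g.left.1 (Multiplicative.ofAdd (x - walkerPos h)) = 1
    · rw [h1, mul_one]
    · have := hg _ h1
      omega
  have e1 := hfar y (by omega)
  have e2 := hfar z (by omega)
  constructor
  · intro hl x hx
    by_cases hx' : x < walkerPos h - K ∨ walkerPos h + K < x
    · exact hl x (by rwa [hfar x hx'])
    · have := hl y (by rwa [e1])
      have := hl z (by rwa [e2])
      omega
  · intro hl x hx
    by_cases hx' : x < walkerPos h - K ∨ walkerPos h + K < x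
    · exact hl x (by rwa [← hfar x hx'])
    · have := hl y hy'
      have := hl z hz'
      omega

theorem lampDensity_congr [Fintype F] {h h' : 𝓖} (hpos : walkerPos h = walkerPos h')
    (hl : ∀ a b, LampsIn h a b ↔ LampsIn h' a b) : lampDensity h = lampDensity h' := by
  ext s
  have e : (s.pos = walkerPos h ∧ LampsIn h s.lo s.hi) ↔
      (s.pos = walkerPos h' ∧ LampsIn h' s.lo s.hi) := by rw [hpos, hl]
  simp only [lampDensity]
  split_ifs with h1 h2 h2
  · rfl
  · exact absurd (e.1 h1) h2
  · exact absurd (e.2 h2) h1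
  · rfl

theorem LampsBeyond.lampDensity_mul [Fintype F] {h g : 𝓖} {r : ℕ} {K : ℤ} (hh : LampsBeyond h r)
    (hg : LampsIn g (-K) K) (hK : K < r) :
    lampDensity (h * g) = lampDensity (h * walk (walkerPos g)) := by
  refine lampDensity_congr ?_ fun a b => ?_
  · rw [walkerPos_mul, walkerPos_mul, walkerPos_walk]
  · rw [hh.lampsIn_mul_iff hg hK, lampsIn_mul_walk]

/-- Given the state, the configurations confined to `[a, b]` leave at least `L` visited sites
trivial, each at a cost of `|F|⁻¹`. -/
theorem sum_lampDensity_le [Fintype F] (H : Finset 𝓖) (s : RangeState) (a b : ℤ) (L : ℕ)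
    (hH : ∀ h ∈ H, LampsIn h s.lo s.hi → s.pos = walkerPos h → LampsIn h a b)
    (hL : (b - a + 1).toNat + L ≤ (s.hi - s.lo + 1).toNat) :
    ∑ h ∈ H, lampDensity h s ≤ ((Fintype.card F : ℝ)⁻¹) ^ L := by
  classical
  have hF : (0 : ℝ) < Fintype.card F := by exact_mod_cast Fintype.card_pos
  have hF1 : (1 : ℝ) ≤ Fintype.card F := by exact_mod_cast Nat.one_le_iff_ne_zero.2 Fintype.card_ne_zero
  simp only [lampDensity]
  rw [← Finset.sum_filter, Finset.sum_const, nsmul_eq_mul]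
  have h1 := card_lampsIn_le
    (H.filter fun h => s.pos = walkerPos h ∧ LampsIn h s.lo s.hi) s.pos a b (by
      intro h hh
      rw [Finset.mem_filter] at hh
      exact ⟨hh.2.1.symm, hH h hh.1 hh.2.2 hh.2.1⟩)
  have h2 : ((H.filter fun h => s.pos = walkerPos h ∧ LampsIn h s.lo s.hi).card : ℝ) ≤
      (Fintype.card F : ℝ) ^ (b - a + 1).toNat := by exact_mod_cast h1
  calc _ ≤ (Fintype.card F : ℝ) ^ (b - a + 1).toNat *
        ((Fintype.card F : ℝ)⁻¹) ^ ((b - a + 1).toNat + L) := by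
        refine mul_le_mul h2 ?_ (by positivity) (by positivity)
        exact pow_le_pow_of_le_one (by positivity) (inv_le_one_of_one_le₀ hF1) hL
    _ = _ := by
        rw [pow_add, ← mul_assoc, ← mul_pow, mul_inv_cancel₀ hF.ne', one_pow, one_mul]

section Chain

variable [Fintype F] {p q : ℝ} {n : ℕ} {σ : Bool}

open Classical in
theorem expect_lampDensity (hp : 0 ≤ p) (hq : 0 ≤ q) (h : 𝓖) :
    expect p q n σ (lampDensity h) =
      ∑ x ∈ Finset.Icc (-(n : ℤ)) n ×ˢ Finset.Icc (-(n : ℤ)) n,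
        (if LampsIn h x.1 x.2 then ((Fintype.card F : ℝ)⁻¹) ^ (x.2 - x.1 + 1).toNat else 0) *
          rangeLaw p q n σ x.1 x.2 (walkerPos h) := by
  simp only [rangeLaw, ← smul_eq_mul (a := (_ : ℝ)), ← map_smul, ← map_sum]
  refine expect_congr hp hq fun s hs => ?_
  obtain ⟨h1, h2, h3, h4⟩ := hs
  simp only [Finset.sum_apply, Pi.smul_apply, smul_eq_mul]
  rw [Finset.sum_eq_single (s.lo, s.hi)]
  · simp only [lampDensity, true_and]
    by_cases h5 : s.pos = walkerPos h <;> simp [h5]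
  · rintro x - hx
    rw [if_neg (c := s.lo = x.1 ∧ _), mul_zero]
    rintro ⟨h5, h6, -⟩
    exact hx (Prod.ext h5.symm h6.symm)
  · intro hx
    exfalso
    apply hx
    simp only [Finset.mem_product, Finset.mem_Icc]
    omega

/-- For fixed interval and position, the number of configurations cancels the density. The far lamps
keep the walker at least `r` from the ends of every contributing interval, and the shift by `j`
still leaves `ρ`. -/
theorem sum_abs_expect_lampDensity_sub_le (hp : 0 ≤ p) (hq : 0 ≤ q) {r ρ : ℕ} {j : ℤ}
    (hr : ρ + |j| < r) (H : Finset 𝓖) (hH : ∀ h ∈ H, LampsBeyond h r) :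
    ∑ h ∈ H, |expect p q n σ (lampDensity (h * walk (j + 1))) -
        expect p q n σ (lampDensity (h * walk j))| ≤
      ∑ x ∈ Finset.Icc (-(n : ℤ)) n ×ˢ Finset.Icc (-(n : ℤ)) n,
        ∑ m ∈ Finset.Ico (x.1 + ρ) (x.2 - ρ),
          |rangeLaw p q n σ x.1 x.2 (m + 1) - rangeLaw p q n σ x.1 x.2 m| := by
  classical
  have hF : (0 : ℝ) < Fintype.card F := by exact_mod_cast Fintype.card_pos
  have h1 : ∀ h ∈ H, |expect p q n σ (lampDensity (h * walk (j + 1))) -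
        expect p q n σ (lampDensity (h * walk j))| ≤
      ∑ x ∈ Finset.Icc (-(n : ℤ)) n ×ˢ Finset.Icc (-(n : ℤ)) n,
        (if LampsIn h x.1 x.2 then ((Fintype.card F : ℝ)⁻¹) ^ (x.2 - x.1 + 1).toNat *
          |rangeLaw p q n σ x.1 x.2 (walkerPos h + j + 1) -
            rangeLaw p q n σ x.1 x.2 (walkerPos h + j)| else 0) := by
    intro h _
    rw [expect_lampDensity hp hq, expect_lampDensity hp hq, ← Finset.sum_sub_distrib]
    refine (Finset.abs_sum_le_sum_abs _ _).trans (Finset.sum_le_sum fun x _ => ?_)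
    simp only [lampsIn_mul_walk, walkerPos_mul, walkerPos_walk]
    rw [← mul_sub, abs_mul, ← add_assoc]
    split_ifs
    · rw [abs_of_nonneg (by positivity)]
    · simp
  refine (Finset.sum_le_sum h1).trans ?_
  rw [Finset.sum_comm]
  refine Finset.sum_le_sum fun x _ => ?_
  obtain ⟨a, b⟩ := x
  rw [← Finset.sum_filter]
  rw [← Finset.sum_fiberwise_of_maps_to (t := Finset.Ico (a + (ρ : ℤ)) (b - ρ))
    (g := fun h => walkerPos h + j)]
  · refine Finset.sum_le_sum fun m _ => ?_
    have h2 : ∀ h ∈ (H.filter fun h => LampsIn h a b).filter (fun h => walkerPos h + j = m),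
        ((Fintype.card F : ℝ)⁻¹) ^ (b - a + 1).toNat *
          |rangeLaw p q n σ a b (walkerPos h + j + 1) - rangeLaw p q n σ a b (walkerPos h + j)| =
        ((Fintype.card F : ℝ)⁻¹) ^ (b - a + 1).toNat *
          |rangeLaw p q n σ a b (m + 1) - rangeLaw p q n σ a b m| := by
      intro h hh
      rw [(Finset.mem_filter.1 hh).2]
    rw [Finset.sum_congr rfl h2, Finset.sum_const, nsmul_eq_mul, ← mul_assoc]
    refine mul_le_of_le_one_left (abs_nonneg _) ?_
    have h3 := card_lampsIn_le
      ((H.filter fun h => LampsIn h a b).filter fun h => walkerPos h + j = m) (m - j) a b (by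
        intro h hh
        rw [Finset.mem_filter, Finset.mem_filter] at hh
        exact ⟨by omega, hh.1.2⟩)
    have h4 : ((((H.filter fun h => LampsIn h a b).filter fun h => walkerPos h + j = m).card : ℕ) : ℝ) ≤
        (Fintype.card F : ℝ) ^ (b - a + 1).toNat := by exact_mod_cast h3
    rw [inv_pow]
    exact mul_inv_le_one_of_le₀ h4 (by positivity)
  · intro h hh
    rw [Finset.mem_filter] at hh
    obtain ⟨⟨y, hy, hy'⟩, ⟨z, hz, hz'⟩⟩ := hH h hh.1
    have := hh.2 y hy'
    have := hh.2 z hz'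
    have := neg_abs_le j
    have := le_abs_self j
    rw [Finset.mem_Ico]
    omega

/-- Either the walker is within `r + L` of an end of its range, or on one side at least `L` visited
sites at distance at least `r` all carry trivial lamps. -/
theorem sum_expect_lampDensity_le (hp : 0 ≤ p) (hq : 0 < q) (hpq : p + 2 * q = 1) (hn : 0 < n)
    {r : ℕ} (L : ℕ) (H : Finset 𝓖) (hH : ∀ h ∈ H, ¬ LampsBeyond h r) :
    ∑ h ∈ H, expect p q n σ (lampDensity h) ≤
      2 * (r + L) / (q * √n) + 2 * ((Fintype.card F : ℝ)⁻¹) ^ L := by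
  classical
  have hF : (0 : ℝ) < Fintype.card F := by exact_mod_cast Fintype.card_pos
  have hn' : (0 : ℝ) < √n := Real.sqrt_pos.2 (by exact_mod_cast hn)
  have key : ∀ s : RangeState, s.InRange n → (∑ h ∈ H, lampDensity h) s ≤
      ((fun s : RangeState => if s.hi - s.pos < (r + L : ℕ) then (1 : ℝ) else 0) +
        (fun s : RangeState => if s.pos - s.lo < (r + L : ℕ) then (1 : ℝ) else 0) +
        (fun _ => 2 * ((Fintype.card F : ℝ)⁻¹) ^ L) : RangeState → ℝ) s := by
    intro s hs
    obtain ⟨h1, h2, h3, h4⟩ := hs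
    rw [Finset.sum_apply]
    simp only [Pi.add_apply]
    have hpow : 0 ≤ 2 * ((Fintype.card F : ℝ)⁻¹) ^ L := by positivity
    by_cases h5 : s.hi - s.pos < (r + L : ℕ) ∨ s.pos - s.lo < (r + L : ℕ)
    · have h6 : ∑ h ∈ H, lampDensity h s ≤ 1 := by
        simpa using sum_lampDensity_le H s s.lo s.hi 0 (fun h _ hl _ => hl) (by omega)
      refine h6.trans ?_
      rcases h5 with h5 | h5
      · rw [if_pos h5]; split_ifs <;> linarith
      · rw [if_pos h5]; split_ifs <;> linarith
    · push Not at h5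
      push_cast at h5
      rw [if_neg (by push_cast; omega), if_neg (by push_cast; omega), zero_add, zero_add]
      -- Elements with a far lamp on the left lack one on the right; the others lack one on the
      -- left.
      rw [← Finset.sum_filter_add_sum_filter_not H (fun h =>
        ∃ x : ℤ, x ≤ walkerPos h - r ∧ h.left.1 (Multiplicative.ofAdd x) ≠ 1), two_mul]
      refine add_le_add ?_ ?_
      · refine sum_lampDensity_le _ s s.lo (s.pos + r - 1) L ?_ (by omega)
        intro h hh hl hpos x hx
        rw [Finset.mem_filter] at hh
        have h7 : ¬ (walkerPos h + r ≤ x) := fun h' => hH h hh.1 ⟨hh.2, x, h', hx⟩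
        have := hl x hx
        omega
      · refine sum_lampDensity_le _ s (s.pos - r + 1) s.hi L ?_ (by omega)
        intro h hh hl hpos x hx
        rw [Finset.mem_filter] at hh
        have h7 : ¬ (x ≤ walkerPos h - r) := fun h' => hh.2 ⟨x, h', hx⟩
        have := hl x hx
        omega
  rw [← map_sum]
  refine (expect_mono hp hq.le key).trans ?_
  rw [map_add, map_add, expect_const hpq]
  have e1 := expect_drawdown_lt_le (n := n) (σ := σ) hp hq hpq (r + L)
  have e2 := expect_drawup_lt_le (n := n) (σ := σ) hp hq hpq (r + L)
  have e3 : ∀ y : ℝ, q * √n * y ≤ (r + L : ℕ) → y ≤ (r + L) / (q * √n) := by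
    intro y hy
    rw [le_div_iff₀ (by positivity)]
    push_cast at hy
    linarith
  have := e3 _ e1
  have := e3 _ e2
  rw [show 2 * ((r : ℝ) + L) / (q * √n) = (r + L) / (q * √n) + (r + L) / (q * √n) by ring]
  gcongr

end Chain

/-! ### Regular sets of large probability -/

/-- On the scale `c * √n`, and for configurations in `V`, lamp changes do not affect the probability
of the `n`-step walk, and moving the walker by one changes the mass by `O(1 / √n)` in total. -/
structure RegularOn (μ : PMF 𝓖) (n : ℕ) (c C : ℝ) (V : Set 𝓖) : Prop where
  lamps : ∀ h ∈ V, ∀ (g : 𝓖) (K : ℤ), (K : ℝ) ≤ c * √n → LampsIn g (-K) K →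
    stepProb μ n (h * g) = stepProb μ n (h * walk (walkerPos g))
  variation : ∀ j : ℤ, ((|j| : ℤ) : ℝ) ≤ c * √n → ∀ H : Finset 𝓖, (∀ h ∈ H, h ∈ V) →
    ∑ h ∈ H, |stepProb μ n (h * walk (j + 1)) - stepProb μ n (h * walk j)| ≤ C / √n

/-- With trivial lamps `LampsBeyond` never holds, so this case is treated separately, through the
walker alone. -/
theorem regularOn_univ_of_subsingleton [Fintype F] [Subsingleton F] {μ : PMF 𝓖} {p q : ℝ}
    (hp : 0 < p) (hq : 0 < q) (hpq : p + 2 * q = 1) {n : ℕ} (hn : 0 < n)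
    (hμ : ∀ h, stepProb μ n h = expect p q n true (lampDensity h)) :
    RegularOn μ n 1 (20 / (1 - |p - 2 * q|)) Set.univ := by
  have hl : ∀ (h : 𝓖) a b, LampsIn h a b := fun h a b x hx => absurd (Subsingleton.elim _ _) hx
  have hcard : (Fintype.card F : ℝ) = 1 := by
    exact_mod_cast Fintype.card_eq_one_iff_nonempty_unique.2 ⟨⟨⟨1⟩, fun _ => Subsingleton.elim _ _⟩⟩
  have hθ : 0 < 1 - |p - 2 * q| := sub_pos.2 (abs_sub_two_mul_lt_one hp hq hpq)
  have hn' : (1 : ℝ) ≤ √n := Real.one_le_sqrt.2 (by exact_mod_cast hn)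
  have hsq : √(n : ℝ) * √n = n := Real.mul_self_sqrt (by positivity)
  have hlaw : ∀ h, stepProb μ n h = lazyWalk p q n (walkerPos h) := by
    intro h
    rw [hμ, ← expect_pos_eq (σ := true)]
    congr 1
    ext s
    simp [lampDensity, hl, hcard]
  constructor
  · intro h _ g K _ _
    rw [hlaw, hlaw, walkerPos_mul, walkerPos_mul, walkerPos_walk]
  · intro j _ H _
    have hinj : Set.InjOn (fun h : 𝓖 => walkerPos h + j) H := by
      intro h _ h' _ he
      refine SemidirectProduct.ext (Subtype.ext (Subsingleton.elim _ _)) ?_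
      exact Multiplicative.toAdd.injective (add_right_cancel he)
    have h1 := sum_abs_lazyWalk_step_le (n := n) hp hq hpq (H.image fun h : 𝓖 => walkerPos h + j)
    rw [Finset.sum_image hinj] at h1
    simp only [hlaw, walkerPos_mul, walkerPos_walk, ← add_assoc]
    set Z := ∑ h ∈ H, |lazyWalk p q n (walkerPos h + j + 1) - lazyWalk p q n (walkerPos h + j)|
    rw [div_div, le_div_iff₀ (by positivity)]
    refine le_of_mul_le_mul_right ?_ (show 0 < √(n : ℝ) by linarith)
    calc Z * ((1 - |p - 2 * q|) * √n) * √n = (1 - |p - 2 * q|) * ((√n * √n) * Z) := by ring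
      _ ≤ 10 * (1 + √n) := by rw [hsq]; exact h1
      _ ≤ 20 * √n := by linarith

theorem regularOn_lampsBeyond [Fintype F] {μ : PMF 𝓖} {p q : ℝ}
    (hp : 0 < p) (hq : 0 < q) (hpq : p + 2 * q = 1) {n : ℕ} (hn : 0 < n)
    (hμ : ∀ h, stepProb μ n h = expect p q n true (lampDensity h)) {δ : ℝ} (hδ : 0 < δ)
    (hδn : 8 ≤ δ * √n) :
    RegularOn μ n (δ / 4) (2048 / ((1 - |p - 2 * q|) * δ ^ 2))
      {h | LampsBeyond h ⌊δ * √n⌋₊} := by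
  have hθ : 0 < 1 - |p - 2 * q| := sub_pos.2 (abs_sub_two_mul_lt_one hp hq hpq)
  have hn' : (1 : ℝ) ≤ √n := Real.one_le_sqrt.2 (by exact_mod_cast hn)
  have hr := Nat.lt_floor_add_one (δ * √n)
  constructor
  · intro h hh g K hK hg
    rw [hμ, hμ, LampsBeyond.lampDensity_mul hh hg]
    have : (K : ℝ) < (⌊δ * √n⌋₊ : ℤ) := by push_cast; linarith
    exact_mod_cast this
  · intro j hj H hH
    -- Both `ρ` and `|j|` are at most `δ√n/4`, so their sum stays below `⌊δ√n⌋₊`. As `δ√n ≥ 8`, also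
    -- `ρ ≥ δ√n/8`, and `2048 = 8² · 16 · 2`.
    set ρ := ⌊δ / 4 * √n⌋₊ with hρ
    have hρ1 := Nat.lt_floor_add_one (δ / 4 * √n)
    have hρ2 := Nat.floor_le (show 0 ≤ δ / 4 * √n by positivity)
    rw [← hρ] at hρ1 hρ2
    have hρ3 : δ / 8 * √n ≤ ρ := by linarith
    have hρ0 : 0 < ρ := by
      have : (0 : ℝ) < ρ := by linarith
      exact_mod_cast this
    have h1 : (ρ : ℤ) + |j| < (⌊δ * √n⌋₊ : ℤ) := by
      have : ((ρ : ℤ) : ℝ) + ((|j| : ℤ) : ℝ) < ((⌊δ * √n⌋₊ : ℤ) : ℝ) := by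
        rw [Int.cast_natCast, Int.cast_natCast]; linarith
      exact_mod_cast this
    have h2 := sum_abs_expect_lampDensity_sub_le (n := n) (σ := true) hp.le hq.le h1 H hH
    have h3 := sum_abs_rangeLaw_step_le (n := n) (σ := true) hp hq hpq
      (Finset.Icc (-(n : ℤ)) n ×ˢ Finset.Icc (-(n : ℤ)) n) hρ0
    simp only [hμ]
    refine h2.trans ?_
    set Z := ∑ x ∈ Finset.Icc (-(n : ℤ)) n ×ˢ Finset.Icc (-(n : ℤ)) n,
        ∑ m ∈ Finset.Ico (x.1 + ρ) (x.2 - ρ),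
          |rangeLaw p q n true x.1 x.2 (m + 1) - rangeLaw p q n true x.1 x.2 m|
    have hZ : 0 ≤ Z := Finset.sum_nonneg fun _ _ => Finset.sum_nonneg fun _ _ => abs_nonneg _
    rw [div_div, le_div_iff₀ (by positivity)]
    refine le_of_mul_le_mul_right ?_ (show 0 < √(n : ℝ) by linarith)
    calc Z * ((1 - |p - 2 * q|) * δ ^ 2 * √n) * √n
        = 64 * ((1 - |p - 2 * q|) * ((δ / 8 * √n) ^ 2 * Z)) := by ring
      _ ≤ 64 * ((1 - |p - 2 * q|) * ((ρ : ℝ) ^ 2 * Z)) := by gcongr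
      _ ≤ 64 * (16 * (1 + √n)) := by gcongr
      _ ≤ 2048 * √n := by linarith

theorem exists_regularOn [Fintype F] {μ : PMF 𝓖} (hμ : IsStandardSimpleSwitchWalkSwitch μ)
    {ε : ℝ} (hε : 0 < ε) :
    ∃ c C : ℝ, 0 < c ∧ 0 < C ∧ ∃ n₀ : ℕ, ∀ n, n₀ ≤ n → ∃ V : Set 𝓖, RegularOn μ n c C V ∧
      ∀ H : Finset 𝓖, (∀ h ∈ H, h ∉ V) → ∑ h ∈ H, stepProb μ n h ≤ ε := by
  obtain ⟨p, q, hp, hq, hpq, hstep⟩ := exists_stepProb_eq_expect hμ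
  have hθ : 0 < 1 - |p - 2 * q| := sub_pos.2 (abs_sub_two_mul_lt_one hp hq hpq)
  rcases subsingleton_or_nontrivial F with hF | hF
  · refine ⟨1, _, one_pos, div_pos (by norm_num : (0 : ℝ) < 20) hθ, 1, fun n hn => ⟨Set.univ,
      regularOn_univ_of_subsingleton hp hq hpq hn (hstep n hn), fun H hH => ?_⟩⟩
    rw [Finset.sum_eq_zero fun h hh => absurd (Set.mem_univ h) (hH h hh)]
    exact hε.le
  obtain ⟨L, hL⟩ := exists_pow_lt_of_lt_one (show 0 < ε / 4 by positivity)
    (show ((Fintype.card F : ℝ)⁻¹) < 1 from inv_lt_one_of_one_lt₀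
      (by exact_mod_cast Fintype.one_lt_card))
  -- Being near an end costs at most `2δ/q + 2L/(q√n) ≤ ε/4 + ε/4`, trivial lamps at most `2|F|^{-L}
  -- ≤ ε/2`.
  set δ := q * ε / 8 with hδ
  have hδ0 : 0 < δ := by positivity
  have ht : Tendsto (fun n : ℕ => √(n : ℝ)) atTop atTop :=
    Real.tendsto_sqrt_atTop.comp tendsto_natCast_atTop_atTop
  obtain ⟨n₀, hn₀⟩ := eventually_atTop.1 ((ht.eventually_ge_atTop (8 / δ)).and
    ((ht.eventually_ge_atTop (8 * L / (q * ε))).and (eventually_gt_atTop 0)))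
  refine ⟨δ / 4, 2048 / ((1 - |p - 2 * q|) * δ ^ 2), by positivity, by positivity, n₀,
    fun n hn => ?_⟩
  obtain ⟨h1, h2, h3⟩ := hn₀ n hn
  rw [div_le_iff₀ hδ0, mul_comm] at h1
  rw [div_le_iff₀ (by positivity)] at h2
  refine ⟨_, regularOn_lampsBeyond hp hq hpq h3 (hstep n h3) hδ0 h1, fun H hH => ?_⟩
  simp only [hstep n h3]
  have h4 := sum_expect_lampDensity_le (n := n) (σ := true) hp.le hq hpq h3 L H hH
  have hn' : (0 : ℝ) < √n := Real.sqrt_pos.2 (by exact_mod_cast h3)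
  have h5 := Nat.floor_le (show 0 ≤ δ * √n by positivity)
  have h6 : 2 * ((⌊δ * √n⌋₊ : ℝ) + L) / (q * √n) ≤ ε / 2 := by
    rw [div_le_iff₀ (by positivity)]
    rw [hδ] at h5 ⊢
    linarith
  linarith

/-! ### Word metric, Markov's inequality and conclusion -/

theorem exists_lampsIn (g : 𝓖) : ∀ᶠ C : ℕ in atTop, LampsIn g (-C) C ∧ |walkerPos g| ≤ C := by
  have hfin : (Function.mulSupport g.left.1).Finite := g.left.2
  have h1 : ∀ᶠ C : ℕ in atTop, ∀ x ∈ Function.mulSupport g.left.1,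
      |Multiplicative.toAdd x| ≤ (C : ℤ) := by
    rw [Filter.eventually_all_finite hfin]
    intro x _
    filter_upwards [eventually_ge_atTop (Multiplicative.toAdd x).natAbs] with C hC
    rw [Int.abs_eq_natAbs]
    exact_mod_cast hC
  filter_upwards [h1, eventually_ge_atTop (walkerPos g).natAbs] with C hC hC'
  refine ⟨fun x hx => abs_le.1 (hC _ hx), ?_⟩
  rw [Int.abs_eq_natAbs]
  exact_mod_cast hC'

theorem exists_list_length_eq_wordLength {G : Type*} [Group G] {S : Set G}
    (hS : Subgroup.closure S = ⊤) (g : G) :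
    ∃ l : List G, (∀ x ∈ l, x ∈ S ∨ x⁻¹ ∈ S) ∧ l.prod = g ∧ l.length = wordLength S g := by
  have hne : {n | ∃ l : List G, (∀ x ∈ l, x ∈ S ∨ x⁻¹ ∈ S) ∧ l.prod = g ∧ l.length = n}.Nonempty := by
    obtain ⟨l, hl, hl'⟩ := Submonoid.exists_list_of_mem_closure
      (show g ∈ Submonoid.closure (S ∪ S⁻¹) by
        rw [← Subgroup.closure_toSubmonoid, hS]; trivial)
    exact ⟨_, l, hl, hl', rfl⟩
  exact Nat.sInf_mem hne

theorem exists_lampsIn_wordLength {S : Set 𝓖} (hS : S.Finite) (hgen : Subgroup.closure S = ⊤) :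
    ∃ C : ℕ, 0 < C ∧ ∀ g : 𝓖, LampsIn g (-(C * wordLength S g : ℕ)) (C * wordLength S g : ℕ) ∧
      |walkerPos g| ≤ (C * wordLength S g : ℕ) := by
  have h1 : ∀ᶠ C : ℕ in atTop, ∀ x ∈ S ∪ S⁻¹, LampsIn x (-C) C ∧ |walkerPos x| ≤ C := by
    rw [Filter.eventually_all_finite (hS.union hS.inv)]
    exact fun x _ => exists_lampsIn x
  obtain ⟨C, hC, hC0⟩ := (h1.and (eventually_gt_atTop 0)).exists
  refine ⟨C, hC0, fun g => ?_⟩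
  obtain ⟨l, hl, rfl, hlen⟩ := exists_list_length_eq_wordLength hgen g
  rw [← hlen]
  clear hlen
  induction l with
  | nil =>
    refine ⟨fun x hx => absurd rfl hx, ?_⟩
    simp [walkerPos]
  | cons x l ih =>
    obtain ⟨e1, e2⟩ := ih fun y hy => hl y (List.mem_cons_of_mem _ hy)
    obtain ⟨e3, e4⟩ := hC x (hl x List.mem_cons_self)
    have e5 : ((C * (x :: l).length : ℕ) : ℤ) = C + (C * l.length : ℕ) := by
      rw [List.length_cons]; push_cast; ring
    rw [List.prod_cons, e5]
    refine ⟨e3.mul e4 e1 (by positivity), ?_⟩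
    rw [walkerPos_mul]
    exact (abs_add_le _ _).trans (add_le_add e4 e2)

/-- Disposes of the finitely many small times, at which the balls are made trivial. -/
theorem eq_one_of_mem_wordBall {G : Type*} [Group G] {S : Set G}
    (hS : Subgroup.closure S = ⊤) {r : ℝ} (hr : r < 1) {g : G} (hg : g ∈ wordBall S r) : g = 1 := by
  obtain ⟨l, -, rfl, hlen⟩ := exists_list_length_eq_wordLength hS g
  have h1 : (wordLength S l.prod : ℝ) < 1 := lt_of_le_of_lt hg hr
  have h2 : wordLength S l.prod = 0 := by
    have : wordLength S l.prod < 1 := by exact_mod_cast h1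
    omega
  rw [h2, List.length_eq_zero_iff] at hlen
  rw [hlen, List.prod_nil]

theorem one_sub_le_stepProbSet {G : Type*} [Group G] {μ : PMF G} {n : ℕ} {V : Set G} {ε : ℝ}
    (hε : 0 ≤ ε) (h : ∀ H : Finset G, (∀ x ∈ H, x ∉ V) → ∑ x ∈ H, stepProb μ n x ≤ ε) :
    1 - ε ≤ stepProbSet μ n V := by
  classical
  set ξ := pmfConvPow μ n with hξ
  have h1 : ξ.toOuterMeasure Vᶜ ≤ ENNReal.ofReal ε := by
    rw [PMF.toOuterMeasure_apply, ENNReal.tsum_eq_iSup_sum]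
    refine iSup_le fun H => ?_
    have e : ∑ x ∈ H, Vᶜ.indicator ξ x = ∑ x ∈ H.filter (fun x => x ∉ V), ξ x := by
      rw [Finset.sum_filter]
      exact Finset.sum_congr rfl fun x _ => by simp [Set.indicator_apply]
    rw [e, ← ENNReal.ofReal_toReal (a := ∑ x ∈ H.filter (fun x => x ∉ V), ξ x)
      (ENNReal.sum_ne_top.2 fun x _ => PMF.apply_ne_top _ _),
      ENNReal.toReal_sum fun x _ => PMF.apply_ne_top _ _]
    exact ENNReal.ofReal_le_ofReal (h _ fun x hx => (Finset.mem_filter.1 hx).2)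
  have h2 : (1 : ENNReal) ≤ ξ.toOuterMeasure V + ξ.toOuterMeasure Vᶜ := by
    have : ξ.toOuterMeasure (V ∪ Vᶜ) = 1 := by
      rw [PMF.toOuterMeasure_apply_eq_one_iff, Set.union_compl_self]
      exact Set.subset_univ _
    rw [← this]
    exact MeasureTheory.measure_union_le _ _
  have h3 : ξ.toOuterMeasure V ≠ ⊤ := by
    refine ne_top_of_le_ne_top ENNReal.one_ne_top ?_
    rw [← (PMF.toOuterMeasure_apply_eq_one_iff ξ (s := Set.univ)).2 (Set.subset_univ _)]
    exact MeasureTheory.measure_mono (Set.subset_univ _)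
  have h4 := h2.trans (add_le_add_right h1 _)
  have h5 := ENNReal.toReal_mono (ENNReal.add_ne_top.2 ⟨h3, ENNReal.ofReal_ne_top⟩) h4
  rw [ENNReal.toReal_add h3 ENNReal.ofReal_ne_top, ENNReal.toReal_ofReal hε, ENNReal.toReal_one] at h5
  rw [stepProbSet, ← hξ]
  linarith

theorem abs_sub_le_sum_abs_step (f : ℤ → ℝ) (K : ℕ) {k : ℤ} (hk : |k| ≤ K) :
    |f k - f 0| ≤ ∑ j ∈ Finset.Ico (-(K : ℤ)) K, |f (j + 1) - f j| := by
  induction K generalizing k with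
  | zero =>
    have : k = 0 := by simpa using hk
    subst this; simp
  | succ K ih =>
    rw [abs_le] at hk
    push_cast at hk
    have hsub : Finset.Ico (-(K : ℤ)) K ⊆ Finset.Ico (-((K + 1 : ℕ) : ℤ)) (K + 1 : ℕ) :=
      Finset.Ico_subset_Ico (by push_cast; omega) (by push_cast; omega)
    have hstep : ∀ j : ℤ, j ∈ Finset.Ico (-((K + 1 : ℕ) : ℤ)) (K + 1 : ℕ) →
        j ∉ Finset.Ico (-(K : ℤ)) K →
        ∑ j ∈ Finset.Ico (-(K : ℤ)) K, |f (j + 1) - f j| + |f (j + 1) - f j| ≤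
          ∑ j ∈ Finset.Ico (-((K + 1 : ℕ) : ℤ)) (K + 1 : ℕ), |f (j + 1) - f j| := by
      intro j hj hj'
      rw [add_comm, ← Finset.sum_insert (f := fun j => |f (j + 1) - f j|) hj']
      exact Finset.sum_le_sum_of_subset_of_nonneg (Finset.insert_subset hj hsub)
        fun _ _ _ => abs_nonneg _
    rcases lt_trichotomy k (-(K : ℤ)) with h | h | h
    · have h1 := ih (k := k + 1) (by rw [abs_le]; omega)
      have h2 := hstep k (by rw [Finset.mem_Ico]; push_cast; omega) (by rw [Finset.mem_Ico]; omega)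
      have h3 := abs_sub_le (f k) (f (k + 1)) (f 0)
      rw [abs_sub_comm (f k) (f (k + 1))] at h3
      linarith
    · exact (ih (by rw [abs_le]; omega)).trans
        (Finset.sum_le_sum_of_subset_of_nonneg hsub fun _ _ _ => abs_nonneg _)
    · rcases eq_or_ne k (K + 1) with rfl | h'
      · have h1 := ih (k := K) (by rw [abs_le]; omega)
        have h2 := hstep K (by rw [Finset.mem_Ico]; push_cast; omega) (by rw [Finset.mem_Ico]; omega)
        have h3 := abs_sub_le (f (K + 1)) (f K) (f 0)
        linarith
      · exact (ih (by rw [abs_le]; omega)).trans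
          (Finset.sum_le_sum_of_subset_of_nonneg hsub fun _ _ _ => abs_nonneg _)

/-- Markov's inequality: a change by the factor `ε` under some `|k| ≤ K` is paid for by the `2K`
unit moves between `-K` and `K`. -/
theorem RegularOn.sum_le_of_not_almost_invariant {μ : PMF 𝓖} {n : ℕ} {c C ε : ℝ} {V : Set 𝓖}
    (hV : RegularOn μ n c C V) (K : ℕ) (hK : K ≤ c * √n) (H : Finset 𝓖)
    (hH : ∀ h ∈ H, h ∈ V)
    (hH' : ∀ h ∈ H, ∃ k : ℤ, |k| ≤ K ∧
      ε * stepProb μ n h ≤ |stepProb μ n (h * walk k) - stepProb μ n h|) :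
    ε * ∑ h ∈ H, stepProb μ n h ≤ 2 * K * (C / √n) := by
  have h1 : ∀ h ∈ H, ε * stepProb μ n h ≤ ∑ j ∈ Finset.Ico (-(K : ℤ)) K,
      |stepProb μ n (h * walk (j + 1)) - stepProb μ n (h * walk j)| := by
    intro h hh
    obtain ⟨k, hk, hk'⟩ := hH' h hh
    have h2 := abs_sub_le_sum_abs_step (fun k => stepProb μ n (h * walk k)) K hk
    have h3 : (walk 0 : 𝓖) = 1 := map_one SemidirectProduct.inr
    simp only [h3, mul_one] at h2
    exact hk'.trans h2
  rw [Finset.mul_sum]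
  refine (Finset.sum_le_sum h1).trans ?_
  rw [Finset.sum_comm]
  calc _ ≤ ∑ j ∈ Finset.Ico (-(K : ℤ)) K, C / √n := by
        refine Finset.sum_le_sum fun j hj => hV.variation j ?_ H hH
        rw [Finset.mem_Ico] at hj
        have : |j| ≤ (K : ℤ) := abs_le.2 ⟨hj.1, hj.2.le⟩
        refine le_trans ?_ hK
        exact_mod_cast this
    _ = _ := by
        rw [Finset.sum_const, Int.card_Ico, nsmul_eq_mul,
          show ((K : ℤ) - -K).toNat = 2 * K by omega]
        push_cast
        ring

theorem exists_small_scale {c₀ D E : ℝ} (hc₀ : 0 < c₀) (hD : 0 < D) (hE : 0 < E) (n₀ : ℕ) :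
    ∃ c : ℝ, 0 < c ∧ D * c ≤ c₀ ∧ E * c ≤ 1 ∧ ∀ n : ℕ, n < n₀ → c * √n < 1 := by
  refine ⟨min (c₀ / D) (min (1 / E) (1 / (√n₀ + 1))), by positivity, ?_, ?_, fun n hn => ?_⟩
  · rw [mul_comm, ← le_div_iff₀ hD]; exact min_le_left _ _
  · rw [mul_comm, ← le_div_iff₀ hE]; exact (min_le_right _ _).trans (min_le_left _ _)
  · have h1 : √(n : ℝ) ≤ √n₀ := Real.sqrt_le_sqrt (by exact_mod_cast hn.le)
    calc _ ≤ 1 / (√(n₀ : ℝ) + 1) * √n₀ := by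
          gcongr
          exact (min_le_right _ _).trans (min_le_right _ _)
      _ < 1 := by
          rw [div_mul_eq_mul_div, one_mul, div_lt_one (by positivity)]
          linarith

theorem exists_almost_invariant [Fintype F] {μ : PMF 𝓖} (hμ : IsStandardSimpleSwitchWalkSwitch μ)
    {S : Set 𝓖} (hSfin : S.Finite) (hSgen : Subgroup.closure S = ⊤) {ε : ℝ} (hε : 0 < ε) :
    ∃ c : ℝ, 0 < c ∧ ∃ V : ℕ → Set 𝓖, ∀ n : ℕ, 1 - ε ≤ stepProbSet μ n (V n) ∧
      ∀ h ∈ V n, 0 < stepProb μ n h ∧ ∀ g ∈ wordBall S (c * √n),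
        |stepProb μ n (h * g) / stepProb μ n h - 1| ≤ ε := by
  classical
  obtain ⟨c₀, C, hc₀, hC, n₀, hreg⟩ := exists_regularOn hμ (half_pos hε)
  obtain ⟨D, hD, hball⟩ := exists_lampsIn_wordLength hSfin hSgen
  have hD' : (0 : ℝ) < D := by exact_mod_cast hD
  -- The bad mass is at most `2DcC/ε`, and `4DCc/ε² ≤ 1` makes it at most `ε/2`. Starting from `n₀ +
  -- 1` ensures `n > 0`.
  obtain ⟨c, hc, hc1, hc2, hc3⟩ := exists_small_scale hc₀ hD'
    (show 0 < 4 * D * C / (ε * ε) by positivity) (n₀ + 1)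
  choose! W hW hWc using hreg
  have hnonneg : ∀ n h, 0 ≤ stepProb μ n h := fun n h => ENNReal.toReal_nonneg
  refine ⟨c, hc, fun n => if n < n₀ + 1 then {h | 0 < stepProb μ n h} else
    {h | h ∈ W n ∧ 0 < stepProb μ n h ∧ ∀ k : ℤ, |k| ≤ ⌊D * c * √n⌋₊ →
      |stepProb μ n (h * walk k) - stepProb μ n h| ≤ ε * stepProb μ n h}, fun n => ?_⟩
  dsimp only
  split_ifs with hn
  · refine ⟨one_sub_le_stepProbSet hε.le fun H hH => ?_, fun h hh => ⟨hh, fun g hg => ?_⟩⟩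
    · refine (Finset.sum_eq_zero fun h hh => ?_).trans_le hε.le
      exact le_antisymm (not_lt.1 (hH h hh)) (hnonneg n h)
    · rw [eq_one_of_mem_wordBall hSgen (hc3 n hn) hg, mul_one, div_self (ne_of_gt hh), sub_self,
        abs_zero]
      exact hε.le
  have hn₀ : n₀ ≤ n := by omega
  have hn' : (0 : ℝ) < √n := Real.sqrt_pos.2 (by exact_mod_cast (show 0 < n by omega))
  have hfl : (⌊D * c * √n⌋₊ : ℝ) ≤ D * c * √n := Nat.floor_le (by positivity)
  have hfl' : (⌊D * c * √n⌋₊ : ℝ) ≤ c₀ * √n := hfl.trans (by gcongr)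
  refine ⟨one_sub_le_stepProbSet hε.le fun H hH => ?_, fun h hh => ⟨hh.2.1, fun g hg => ?_⟩⟩
  · rw [← Finset.sum_filter_add_sum_filter_not H (fun h => h ∈ W n)]
    have h1 := hWc n hn₀ (H.filter fun h => h ∉ W n) fun h hh => (Finset.mem_filter.1 hh).2
    have h2 := (hW n hn₀).sum_le_of_not_almost_invariant (ε := ε) _ hfl' (H.filter fun h => h ∈ W n)
      (fun h hh => (Finset.mem_filter.1 hh).2) (fun h hh => by
        rw [Finset.mem_filter] at hh
        by_cases h0 : 0 < stepProb μ n h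
        · have := hH h hh.1
          simp only [Set.mem_ofPred_eq, hh.2, h0, true_and, not_forall, not_le] at this
          obtain ⟨k, hk, hk'⟩ := this
          exact ⟨k, hk, hk'.le⟩
        -- Points of probability zero satisfy the Markov condition trivially, with `k = 0`.
        · have h0' : stepProb μ n h = 0 := le_antisymm (not_lt.1 h0) (hnonneg n h)
          exact ⟨0, by simp, by rw [h0', mul_zero]; exact abs_nonneg _⟩)
    have h3 : 2 * (⌊D * c * √n⌋₊ : ℝ) * (C / √n) ≤ ε * (ε / 2) := by
      calc _ ≤ 2 * (D * c * √n) * (C / √n) := by gcongr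
        _ = (4 * D * C / (ε * ε) * c) * (ε * (ε / 2)) := by field_simp; ring
        _ ≤ 1 * (ε * (ε / 2)) := by gcongr
        _ = _ := one_mul _
    have h4 := le_of_mul_le_mul_left (h2.trans h3) hε
    linarith
  · obtain ⟨e1, e2⟩ := hball g
    have h1 : ((D * wordLength S g : ℕ) : ℝ) ≤ D * c * √n := by
      push_cast
      rw [mul_assoc]
      exact mul_le_mul_of_nonneg_left hg hD'.le
    rw [(hW n hn₀).lamps h hh.1 g (D * wordLength S g : ℕ) ?_ e1]
    · have h2 := hh.2.2 (walkerPos g) (e2.trans (by exact_mod_cast Nat.le_floor h1))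
      have h0 := hh.2.1
      rw [div_sub_one h0.ne', abs_div, abs_of_pos h0, div_le_iff₀ h0]
      exact h2
    · rw [Int.cast_natCast]
      exact h1.trans (by gcongr)

theorem exists_lamp_invariant [Fintype F] {μ : PMF 𝓖} (hμ : IsStandardSimpleSwitchWalkSwitch μ)
    {S : Set 𝓖} (hSfin : S.Finite) (hSgen : Subgroup.closure S = ⊤) {ε : ℝ} (hε : 0 < ε) :
    ∃ c : ℝ, 0 < c ∧ ∃ V : ℕ → Set 𝓖, ∀ n : ℕ, 1 - ε ≤ stepProbSet μ n (V n) ∧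
      ∀ h ∈ V n, ∀ g ∈ wordBall S (c * √n) ∩ (lampGroup (Multiplicative ℤ) F : Set 𝓖),
        stepProb μ n (h * g) = stepProb μ n h := by
  obtain ⟨c₀, C, hc₀, -, n₀, hreg⟩ := exists_regularOn hμ hε
  obtain ⟨D, hD, hball⟩ := exists_lampsIn_wordLength hSfin hSgen
  have hD' : (0 : ℝ) < D := by exact_mod_cast hD
  obtain ⟨c, hc, hc1, -, hc3⟩ := exists_small_scale hc₀ hD' one_pos n₀
  choose! W hW hWc using hreg
  refine ⟨c, hc, fun n => if n < n₀ then Set.univ else W n, fun n => ?_⟩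
  dsimp only
  split_ifs with hn
  · refine ⟨one_sub_le_stepProbSet hε.le fun H hH => ?_, fun h _ g hg => ?_⟩
    · exact (Finset.sum_eq_zero fun h hh => absurd (Set.mem_univ h) (hH h hh)).trans_le hε.le
    · rw [eq_one_of_mem_wordBall hSgen (hc3 n hn) hg.1, mul_one]
  have hn₀ : n₀ ≤ n := by omega
  refine ⟨one_sub_le_stepProbSet hε.le (hWc n hn₀), fun h hh g hg => ?_⟩
  obtain ⟨hg, f, rfl⟩ := hg
  rw [(hW n hn₀).lamps h hh _ (D * wordLength S (SemidirectProduct.inl f : 𝓖) : ℕ) ?_ (hball _).1]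
  · have : (walk (walkerPos (SemidirectProduct.inl f : 𝓖)) : 𝓖) = 1 :=
      map_one SemidirectProduct.inr
    rw [this, mul_one]
  · rw [Int.cast_natCast]
    push_cast
    calc (D : ℝ) * wordLength S (SemidirectProduct.inl f : 𝓖) ≤ D * (c * √n) :=
          mul_le_mul_of_nonneg_left hg hD'.le
      _ = D * c * √n := by ring
      _ ≤ _ := by gcongr

end Wreath

theorem theorem1 {F : Type*} [Group F] [Fintype F]
    (μ : PMF (WreathProduct (Multiplicative ℤ) F))
    (hμ : IsStandardSimpleSwitchWalkSwitch μ)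
    (S : Set (WreathProduct (Multiplicative ℤ) F)) (hSfin : S.Finite)
    (hSgen : Subgroup.closure S = ⊤) :
    ((∀ ε : ℝ, 0 < ε → ∃ c : ℝ, 0 < c ∧
        ∃ V : ℕ → Set (WreathProduct (Multiplicative ℤ) F),
          ∀ n : ℕ, 1 - ε ≤ stepProbSet μ n (V n) ∧
            ∀ h ∈ V n, 0 < stepProb μ n h ∧
              ∀ g ∈ wordBall S (c * Real.sqrt n),
                |stepProb μ n (h * g) / stepProb μ n h - 1| ≤ ε) ∧
      RadiusAlmostInvarianceGE S μ (fun n => Real.sqrt n)) ∧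
    (∀ ε : ℝ, 0 < ε → ∃ c : ℝ, 0 < c ∧
        ∃ V : ℕ → Set (WreathProduct (Multiplicative ℤ) F),
          ∀ n : ℕ, 1 - ε ≤ stepProbSet μ n (V n) ∧
            ∀ h ∈ V n, ∀ g ∈ wordBall S (c * Real.sqrt n) ∩
                (lampGroup (Multiplicative ℤ) F : Set (WreathProduct (Multiplicative ℤ) F)),
              stepProb μ n (h * g) = stepProb μ n h) := by
  refine ⟨⟨fun ε hε => exists_almost_invariant hμ hSfin hSgen hε, fun r hr ε hε => ?_⟩,
    fun ε hε => exists_lamp_invariant hμ hSfin hSgen hε⟩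
  obtain ⟨c, hc, V, hV⟩ := exists_almost_invariant hμ hSfin hSgen hε
  refine ⟨V, fun n => (hV n).1, fun n h hh => ((hV n).2 h hh).1, ?_⟩
  -- The same sets serve every scale that is `o(√n)`, as it is eventually below `c√n`.
  filter_upwards [hr.eventually_lt_const hc, eventually_gt_atTop 0] with n hn hn0 h hh g hg
  have hn' : (0 : ℝ) < √n := Real.sqrt_pos.2 (by exact_mod_cast hn0)
  have hr' : (wordLength S g : ℝ) ≤ c * √n := le_trans hg ((div_lt_iff₀ hn').1 hn).le
  exact ((hV n).2 h hh).2 g hr'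

end
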